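/- Let $p,q\ge 0$ be integers, $d=p+q\ge 1$, and $\gamma>0$. Split $\mathbb R^d=\mathbb R^p\oplus\mathbb R^q$ and $\mathbb C^d=\mathbb C^p\oplus\mathbb C^q$, writing $\xi=(\xi',\xi'')$ and $x=(x',x'')$; here $\xi'^2=\sum_j\xi_j'^2$, $x'^2=\sum_j x_j'^2$ and $x\xi=\sum_j x_j\xi_j$ (no complex conjugation), similarly for the double-primed variables, and $|\cdot|$ is the Euclidean norm. So $\xi'^2-\xi''^2$ is the symbol of $-\square_{p,q}$, where $\square_{p,q}=\partial_1^2+\dots+\partial_p^2-\partial_{p+1}^2-\dots-\partial_{p+q}^2$. For $z\in\mathbb C_+=\{z\in\mathbb C:\operatorname{Im}z>0\}$ and $x\in\mathbb C^d$ set $$k_\gamma(z,x)=(2\pi)^{-d}\int_{|\xi'|+|\xi''|<\gamma}\frac{e^{ix\xi}}{\xi'^2-\xi''^2-z}\,d\xi ,$$ and let $E$ be the entire function $$E(w)=\frac{i^q}{2^d\pi^{d/2}}\sum_{k=0}^\infty\frac{(-w/4)^k}{k!\,\Gamma(k+d/2)},\qquad w\in\mathbb C .$$ For $z\in\mathbb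 C_+$ let $\sqrt z$ be the square root with $\operatorname{Im}\sqrt z>0$ and $\log z$ the logarithm with $0<\operatorname{Im}\log z<\pi$. Put $\Delta(\gamma^2)=\{z\in\mathbb C:|z|<\gamma^2\}$. 1. If $d$ is odd, there is a function $\chi_\gamma(z,x)$, analytic in $(z,x)\in\Delta(\gamma^2)\times\mathbb C^d$, such that for all $(z,x)\in(\mathbb C_+\cap\Delta(\gamma^2))\times\mathbb C^d$ $$k_\gamma(z,x)=i\pi(\sqrt z)^{d-2}E\bigl(z(x'^2-x''^2)\bigr)+\chi_\gamma(z,x).$$ 2. If $d$ is even, there is a function $\chi_\gamma(z,x)$, analytic in $(z,x)\in\Delta(\gamma^2)\times\mathbb C^d$, such that for all $(z,x)\in(\mathbb C_+\cap\Delta(\gamma^2))\times\mathbb C^d$ $$k_\gamma(z,x)=-(\sqrt z)^{d-2}(\log z)\,E\bigl(z(x'^2-x''^2)\bigr)+\chi_\gamma(z,x).$$ -/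

import Mathlib

noncomputable section

namespace UltraHyperbolic

open MeasureTheory

/-- The frequency space `ℝ^d = ℝ^p ⊕ ℝ^q`, a point being `ξ = (ξ', ξ'')`. Its measure `volume` is
the product of the Lebesgue measures, and `‖ξ.1‖`, `‖ξ.2‖` are the Euclidean norms of `ξ'`, `ξ''`. -/
abbrev Freq (p q : ℕ) : Type := EuclideanSpace ℝ (Fin p) × EuclideanSpace ℝ (Fin q)

/-- The complex position space `ℂ^d = ℂ^p ⊕ ℂ^q`, a point being `x = (x', x'')`. -/
abbrev Pos (p q : ℕ) : Type := (Fin p → ℂ) × (Fin q → ℂ)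

/-- `Ξ(ξ) = ξ'² - ξ''²`, the Fourier symbol of `-□_{p,q}`. -/
def symbol {p q : ℕ} (ξ : Freq p q) : ℝ := ∑ j, ξ.1 j ^ 2 - ∑ j, ξ.2 j ^ 2

/-- The bilinear (not sesquilinear) pairing `x ξ = ∑ x_j ξ_j`. -/
def pairing {p q : ℕ} (x : Pos p q) (ξ : Freq p q) : ℂ :=
  ∑ j, x.1 j * (ξ.1 j : ℂ) + ∑ j, x.2 j * (ξ.2 j : ℂ)

/-- `x'² - x''²` for complex `x`; no complex conjugation is involved. -/
def form {p q : ℕ} (x : Pos p q) : ℂ := ∑ j, x.1 j ^ 2 - ∑ j, x.2 j ^ 2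

/-- The integrand `e^{i x ξ} / (ξ'² - ξ''² - z)`. -/
def integrand {p q : ℕ} (z : ℂ) (x : Pos p q) (ξ : Freq p q) : ℂ :=
  Complex.exp (Complex.I * pairing x ξ) / ((symbol ξ : ℂ) - z)

/-- The domain of integration `|ξ'| + |ξ''| < γ`. -/
def region (p q : ℕ) (γ : ℝ) : Set (Freq p q) := {ξ | ‖ξ.1‖ + ‖ξ.2‖ < γ}

/-- The truncated resolvent kernel
`k_γ(z, x) = (2π)^{-d} ∫_{|ξ'| + |ξ''| < γ} e^{i x ξ} / (ξ'² - ξ''² - z) dξ`, `d = p + q`. -/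
def kernel {p q : ℕ} (γ : ℝ) (z : ℂ) (x : Pos p q) : ℂ :=
  ((2 * Real.pi : ℂ) ^ (p + q))⁻¹ * ∫ ξ in region p q γ, integrand z x ξ

/-- The `k`-th term `(-w/4)^k / (k! Γ(k + d/2))` of the series for `E`. -/
def seriesTerm (d : ℕ) (w : ℂ) (k : ℕ) : ℂ :=
  (-w / 4) ^ k / ((k.factorial : ℂ) * Complex.Gamma ((k : ℂ) + (d : ℂ) / 2))

/-- `E(w) = i^q / (2^d π^{d/2}) ∑_{k ≥ 0} (-w/4)^k / (k! Γ(k + d/2))`, `d = p + q`. -/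
def E (p q : ℕ) (w : ℂ) : ℂ :=
  Complex.I ^ q / ((2 : ℂ) ^ (p + q) * (Real.pi : ℂ) ^ (((p + q : ℕ) : ℂ) / 2)) *
    ∑' k : ℕ, seriesTerm (p + q) w k

/-- The series defining `E` converges for every `w`. -/
theorem summable_seriesTerm (d : ℕ) (w : ℂ) : Summable (seriesTerm d w) := by
  refine Summable.of_norm_bounded_eventually_nat
    (Real.summable_pow_div_factorial ‖w / 4‖) ?_
  filter_upwards [Filter.eventually_ge_atTop 2] with k hk
  have hk' : (2 : ℝ) ≤ (k : ℝ) + (d : ℝ) / 2 := by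
    have h1 : (2 : ℝ) ≤ k := by exact_mod_cast hk
    have h2 : (0 : ℝ) ≤ (d : ℝ) / 2 := by positivity
    linarith
  have hG : 1 ≤ Real.Gamma ((k : ℝ) + (d : ℝ) / 2) := by
    have h := Real.Gamma_strictMonoOn_Ici.monotoneOn (Set.mem_Ici.2 le_rfl) hk' hk'
    rwa [Real.Gamma_two] at h
  have hC : Complex.Gamma ((k : ℂ) + (d : ℂ) / 2) =
      ((Real.Gamma ((k : ℝ) + (d : ℝ) / 2) : ℝ) : ℂ) := by
    rw [← Complex.Gamma_ofReal]
    push_cast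
    rfl
  have hf : (0 : ℝ) < k.factorial := by exact_mod_cast k.factorial_pos
  rw [seriesTerm, hC, norm_div, norm_mul, norm_pow, neg_div, norm_neg, Complex.norm_natCast,
    Complex.norm_real, Real.norm_of_nonneg (by linarith)]
  gcongr
  nlinarith

/-- The integral defining `k_γ(z, x)` converges absolutely for `Im z > 0`. -/
theorem integrableOn_integrand {p q : ℕ} (γ : ℝ) {z : ℂ} (hz : 0 < z.im) (x : Pos p q) :
    IntegrableOn (integrand z x) (region p q γ) := by
  have hne : ∀ ξ : Freq p q, ((symbol ξ : ℂ) - z) ≠ 0 := by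
    intro ξ h
    have h' := congrArg Complex.im h
    simp at h'
    exact hz.ne' h'
  have hc : Continuous (integrand z x) := by
    unfold integrand
    refine Continuous.div ?_ ?_ hne
    · unfold pairing
      fun_prop
    · unfold symbol
      fun_prop
  refine (hc.continuousOn.integrableOn_compact (isCompact_closedBall (0 : Freq p q) γ)).mono_set ?_
  intro ξ hξ
  have h1 : ‖ξ.1‖ + ‖ξ.2‖ < γ := hξ
  have := norm_nonneg ξ.1
  have := norm_nonneg ξ.2
  rw [mem_closedBall_zero_iff, Prod.norm_def]
  exact max_le (by linarith) (by linarith)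

end UltraHyperbolic

end

/-! In polar coordinates for ξ' and ξ'' a plane wave integrates over a sphere to a constant times
`besselSum` (`integral_sphere_exp`), so for p, q ≥ 1 the kernel becomes an integral over the
triangle r, s > 0, r + s < γ. With r = tu and s = t(1 - u) one has r² - s² = t²(2u - 1), and for
fixed t the only pole u = (1 + z/t²)/2 lies in the upper half plane. Deforming [0, 1] to the lower
semicircle u = cos θ e^{-iθ}, 1 - u = i sin θ e^{-iθ} turns the denominator into t² - z e^{2iθ}
(`integral_rotated_eq`). The shape of the truncation matters here: t runs over [0, γ] independently
of u.

For each θ there remains the integral of t^ε G(t²)/(t² - ζ) over [0, γ], where ζ = z e^{2iθ}, G is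
entire, and d = 2l + 1 + ε with ε = 0 for odd and ε = 1 for even d. Replacing G(t²) by G(ζ) costs a
difference quotient, which is analytic in ζ (`integral_resolvent_eq`). The elementary integral of
t^ε/(t² - ζ) is iπ/(2√ζ) or -(log ζ)/2 up to a function analytic for |ζ| < γ²
(`integral_one_div_sq_sub`, `integral_id_div_sq_sub`); this is the source of the square root and the
logarithm. As |ζ| = |z|, all θ share one disc of analyticity.

In the integral of the singular parts over θ all phases cancel, and the addition theorem
`integral_besselSum_mul_besselSum`, a beta integral for each pair of terms, produces `besselSum (p +
q)` at z(x'² - x''²). The factor i^q is i from the contour times i^{q-1} from s^{q-1}. If p = 0 or q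
= 0, no deformation is needed and the same scheme holds with a point mass at θ = π/2 or θ = 0;
`AngularRepresentation` records what the three cases have in common.

Joint analyticity of χ in (z, x) avoids differentiation under the integral: the remainder integrand
is an analytic map into the Banach algebra of continuous functions on a compact parameter space,
followed by a bounded functional (`exists_analytic_remainder`). -/

noncomputable section

open MeasureTheory Set Filter Topology

namespace UltraHyperbolic

/-! ### Polar coordinates. -/

section Polar

variable {E : Type*} [NormedAddCommGroup E] [NormedSpace ℝ E] [MeasurableSpace E] [BorelSpace E]
  [FiniteDimensional ℝ E] (μ : Measure E) [μ.IsAddHaarMeasure]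

/-- The origin, which polar coordinates omit, is a null set because the space is nontrivial. -/
theorem integral_eq_integral_sphere_prod [Nontrivial E] (f : E → ℂ) :
    ∫ x, f x ∂μ =
      ∫ y : Metric.sphere (0 : E) 1 × Ioi (0 : ℝ), f (y.2.1 • y.1.1)
        ∂(μ.toSphere.prod (.volumeIoiPow (Module.finrank ℝ E - 1))) := by
  have h := μ.measurePreserving_homeomorphUnitSphereProd.integral_comp
    (Homeomorph.measurableEmbedding _)
    (fun y : Metric.sphere (0 : E) 1 × Ioi (0 : ℝ) => f (y.2.1 • y.1.1))
  rw [← h, ← restrict_compl_singleton (μ := μ) 0,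
    ← integral_subtype_comap (measurableSet_singleton _).compl f]
  simp only [restrict_compl_singleton]
  refine integral_congr_ae (.of_forall fun x => ?_)
  have hx : ‖x.1‖ ≠ 0 := norm_ne_zero_iff.2 x.2
  simp [homeomorphUnitSphereProd_apply_snd_coe, homeomorphUnitSphereProd_apply_fst_coe, hx]

theorem integrable_sphere_prod {f : E → ℂ} (hf : Integrable f μ) :
    Integrable (fun y : Metric.sphere (0 : E) 1 × Ioi (0 : ℝ) => f (y.2.1 • y.1.1))
      (μ.toSphere.prod (.volumeIoiPow (Module.finrank ℝ E - 1))) := by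
  rw [← μ.measurePreserving_homeomorphUnitSphereProd.integrable_comp_emb
    (Homeomorph.measurableEmbedding _)]
  have h : Integrable (f ∘ Subtype.val) (μ.comap (Subtype.val : ({(0)}ᶜ : Set E) → E)) := by
    rw [← integrableOn_iff_comap_subtypeVal (measurableSet_singleton _).compl]
    exact hf.integrableOn
  refine h.congr (.of_forall fun x => ?_)
  have hx : ‖x.1‖ ≠ 0 := norm_ne_zero_iff.2 x.2
  simp [homeomorphUnitSphereProd_apply_snd_coe, homeomorphUnitSphereProd_apply_fst_coe, hx]

theorem integral_volumeIoiPow (n : ℕ) (g : ℝ → ℂ) :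
    ∫ r : Ioi (0 : ℝ), g r.1 ∂(Measure.volumeIoiPow n) = ∫ r in Ioi (0 : ℝ), (r : ℂ) ^ n * g r := by
  simp only [Measure.volumeIoiPow, ENNReal.ofReal]
  rw [integral_withDensity_eq_integral_smul,
    integral_subtype_comap measurableSet_Ioi fun a ↦ Real.toNNReal (a ^ n) • g a,
    setIntegral_congr_fun measurableSet_Ioi fun x hx ↦ ?_]
  · rw [NNReal.smul_def, Real.coe_toNNReal _ (pow_nonneg hx.out.le _)]
    simp
  · exact (measurable_subtype_coe.pow_const _).real_toNNReal

theorem integral_eq_integral_Ioi_sphere [Nontrivial E] {f : E → ℂ} (hf : Integrable f μ) :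
    ∫ x, f x ∂μ = ∫ r in Ioi (0 : ℝ), (r : ℂ) ^ (Module.finrank ℝ E - 1) *
      ∫ ω : Metric.sphere (0 : E) 1, f (r • ω.1) ∂μ.toSphere := by
  rw [integral_eq_integral_sphere_prod, integral_prod_symm _ (integrable_sphere_prod μ hf),
    integral_volumeIoiPow _ fun r => ∫ ω : Metric.sphere (0 : E) 1, f (r • ω.1) ∂μ.toSphere]

theorem integral_eq_sphere_mul_Ioi [Nontrivial E] {f : E → ℂ} {a : E → ℂ} {b : ℝ → ℂ}
    (hf : ∀ ω : Metric.sphere (0 : E) 1, ∀ r : ℝ, 0 < r → f (r • ω.1) = a ω.1 * b r) :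
    ∫ x, f x ∂μ = (∫ ω : Metric.sphere (0 : E) 1, a ω.1 ∂μ.toSphere) *
      ∫ r in Ioi (0 : ℝ), (r : ℂ) ^ (Module.finrank ℝ E - 1) * b r := by
  rw [integral_eq_integral_sphere_prod, ← integral_volumeIoiPow, ← integral_prod_mul]
  exact integral_congr_ae (.of_forall fun y => hf y.1 y.2.1 y.2.2)

end Polar

/-! ### Spherical means of plane waves. -/

/-- The bilinear pairing of a complex with a real vector. -/
def linearForm {n : ℕ} (x : Fin n → ℂ) (ξ : EuclideanSpace ℝ (Fin n)) : ℂ :=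
  ∑ j, x j * (ξ j : ℂ)

theorem continuous_linearForm {n : ℕ} (x : Fin n → ℂ) : Continuous (linearForm x) := by
  unfold linearForm
  fun_prop

theorem linearForm_smul {n : ℕ} (x : Fin n → ℂ) (r : ℝ) (ξ : EuclideanSpace ℝ (Fin n)) :
    linearForm x (r • ξ) = r * linearForm x ξ := by
  simp only [linearForm, Finset.mul_sum]
  refine Finset.sum_congr rfl fun j _ => ?_
  simp
  ring

theorem norm_linearForm_le {n : ℕ} (x : Fin n → ℂ) (ξ : EuclideanSpace ℝ (Fin n)) :
    ‖linearForm x ξ‖ ≤ (∑ j, ‖x j‖) * ‖ξ‖ := by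
  rw [linearForm, Finset.sum_mul]
  refine (norm_sum_le _ _).trans (Finset.sum_le_sum fun j _ => ?_)
  rw [norm_mul, Complex.norm_real]
  gcongr
  exact PiLp.norm_apply_le ξ j

/-- Moments of a linear form over the unit sphere. -/
def sphereMoment {n : ℕ} (x : Fin n → ℂ) (k : ℕ) : ℂ :=
  ∫ ω : Metric.sphere (0 : EuclideanSpace ℝ (Fin n)) 1, linearForm x ω.1 ^ k ∂volume.toSphere

theorem hasSum_sphereMoment {n : ℕ} (x : Fin n → ℂ) (τ : ℂ) :
    HasSum (fun k : ℕ => τ ^ k / (k.factorial : ℂ) * sphereMoment x k)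
      (∫ ω : Metric.sphere (0 : EuclideanSpace ℝ (Fin n)) 1,
        Complex.exp (τ * linearForm x ω.1) ∂volume.toSphere) := by
  have hc := continuous_linearForm x
  have h := hasSum_integral_of_dominated_convergence (G := ℂ)
    (μ := (volume : Measure (EuclideanSpace ℝ (Fin n))).toSphere)
    (F := fun (k : ℕ) ω => τ ^ k / (k.factorial : ℂ) * linearForm x ω.1 ^ k)
    (f := fun ω => Complex.exp (τ * linearForm x ω.1))
    (fun k _ => (‖τ‖ * ∑ j, ‖x j‖) ^ k / (k.factorial : ℝ))
    (fun k => by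
      apply Continuous.aestronglyMeasurable
      fun_prop)
    (fun k => .of_forall fun ω => by
      have := norm_linearForm_le x ω.1
      rw [norm_eq_of_mem_sphere, mul_one] at this
      rw [norm_mul, norm_div, norm_pow, norm_pow, Complex.norm_natCast, mul_pow, div_mul_eq_mul_div]
      gcongr)
    (.of_forall fun ω => Real.summable_pow_div_factorial _)
    (integrable_const _)
    (.of_forall fun ω => by
      have := NormedSpace.expSeries_div_hasSum_exp (τ * linearForm x ω.1)
      rw [← Complex.exp_eq_exp_ℂ] at this
      simpa [mul_pow, div_mul_eq_mul_div] using this)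
  simpa only [integral_const_mul, ← sphereMoment.eq_def] using! h

theorem integral_gaussian_mul_exp_linearForm {n : ℕ} (x : Fin n → ℂ) (τ : ℂ) :
    ∫ ξ : EuclideanSpace ℝ (Fin n),
      Complex.exp (-(‖ξ‖ : ℂ) ^ 2) * Complex.exp (τ * linearForm x ξ) =
        (Real.pi : ℂ) ^ ((n : ℂ) / 2) * Complex.exp (τ ^ 2 * (∑ j, x j ^ 2) / 4) := by
  rw [← (PiLp.volume_preserving_toLp (Fin n)).integral_comp
    (MeasurableEquiv.toLp 2 _).measurableEmbedding]
  have h := GaussianFourier.integral_cexp_neg_mul_sum_add (b := 1) (by simp) (fun j => τ * x j)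
  simp only [div_one, mul_one, Fintype.card_fin, mul_pow, ← Finset.mul_sum] at h
  rw [← h]
  congr 1
  ext v
  rw [← Complex.exp_add]
  congr 2
  · rw [← Complex.ofReal_pow, EuclideanSpace.norm_sq_eq]
    simp
  · simp [linearForm, Finset.mul_sum, mul_assoc]

theorem integrable_exp_neg_sq_add {n : ℕ} (M : ℝ) :
    Integrable fun ξ : EuclideanSpace ℝ (Fin n) => Real.exp (-‖ξ‖ ^ 2) * Real.exp (M * ‖ξ‖) := by
  have h : Integrable fun ξ : EuclideanSpace ℝ (Fin n) => Real.exp (-(1 / 2) * ‖ξ‖ ^ 2) := by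
    have h := (GaussianFourier.integrable_cexp_neg_mul_sq_norm_add (b := 1 / 2) (by simp) 0
      (0 : EuclideanSpace ℝ (Fin n))).norm
    refine h.congr (.of_forall fun ξ => ?_)
    simp [Complex.norm_exp, ← Complex.ofReal_pow]
  refine (h.const_mul (Real.exp (M ^ 2 / 2))).mono' (by fun_prop) (.of_forall fun ξ => ?_)
  rw [Real.norm_of_nonneg (by positivity), ← Real.exp_add, ← Real.exp_add]
  refine Real.exp_le_exp.2 ?_
  nlinarith [sq_nonneg (M - ‖ξ‖)]

theorem hasSum_gaussian_moment {n : ℕ} (x : Fin n → ℂ) (τ : ℂ) :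
    HasSum (fun k : ℕ => τ ^ k / (k.factorial : ℂ) *
        ∫ ξ : EuclideanSpace ℝ (Fin n), Complex.exp (-(‖ξ‖ : ℂ) ^ 2) * linearForm x ξ ^ k)
      ((Real.pi : ℂ) ^ ((n : ℂ) / 2) * Complex.exp (τ ^ 2 * (∑ j, x j ^ 2) / 4)) := by
  rw [← integral_gaussian_mul_exp_linearForm]
  have hc := continuous_linearForm x
  have hexp : ∀ ξ : EuclideanSpace ℝ (Fin n), HasSum (fun k : ℕ =>
      Real.exp (-‖ξ‖ ^ 2) * ((‖τ‖ * ∑ j, ‖x j‖) * ‖ξ‖) ^ k / (k.factorial : ℝ))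
      (Real.exp (-‖ξ‖ ^ 2) * Real.exp ((‖τ‖ * ∑ j, ‖x j‖) * ‖ξ‖)) := fun ξ => by
    have := NormedSpace.expSeries_div_hasSum_exp ((‖τ‖ * ∑ j, ‖x j‖) * ‖ξ‖)
    rw [← Real.exp_eq_exp_ℝ] at this
    simpa only [mul_div_assoc] using this.mul_left (Real.exp (-‖ξ‖ ^ 2))
  have h := hasSum_integral_of_dominated_convergence (G := ℂ)
    (μ := (volume : Measure (EuclideanSpace ℝ (Fin n))))
    (F := fun (k : ℕ) ξ => τ ^ k / (k.factorial : ℂ) *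
      (Complex.exp (-(‖ξ‖ : ℂ) ^ 2) * linearForm x ξ ^ k))
    (f := fun ξ => Complex.exp (-(‖ξ‖ : ℂ) ^ 2) * Complex.exp (τ * linearForm x ξ))
    (fun k ξ => Real.exp (-‖ξ‖ ^ 2) * ((‖τ‖ * ∑ j, ‖x j‖) * ‖ξ‖) ^ k / (k.factorial : ℝ))
    (fun k => by
      apply Continuous.aestronglyMeasurable
      fun_prop)
    (fun k => .of_forall fun ξ => by
      have := norm_linearForm_le x ξ
      rw [norm_mul, norm_div, norm_pow, norm_mul, norm_pow, Complex.norm_natCast, Complex.norm_exp,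
        mul_assoc ‖τ‖, mul_pow ‖τ‖]
      have h1 : (-(‖ξ‖ : ℂ) ^ 2).re = -‖ξ‖ ^ 2 := by simp [← Complex.ofReal_pow]
      rw [h1]
      calc _ = Real.exp (-‖ξ‖ ^ 2) * (‖τ‖ ^ k * ‖linearForm x ξ‖ ^ k) / (k.factorial : ℝ) := by ring
        _ ≤ _ := by gcongr)
    (.of_forall fun ξ => (hexp ξ).summable)
    (by
      simp only [(hexp _).tsum_eq]
      exact integrable_exp_neg_sq_add _)
    (.of_forall fun ξ => by
      have := NormedSpace.expSeries_div_hasSum_exp (τ * linearForm x ξ)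
      rw [← Complex.exp_eq_exp_ℂ] at this
      refine (this.mul_left (Complex.exp (-(‖ξ‖ : ℂ) ^ 2))).congr_fun fun k => ?_
      simp [mul_pow]
      ring)
  simpa only [integral_const_mul] using h

theorem integral_Ioi_pow_mul_gaussian (m : ℕ) :
    ∫ r in Ioi (0 : ℝ), (r : ℂ) ^ m * Complex.exp (-(r : ℂ) ^ 2) =
      Complex.Gamma (((m + 1 : ℕ) : ℂ) / 2) / 2 := by
  have h := integral_rpow_mul_exp_neg_rpow (p := 2) (q := m) (by norm_num)
    (by have : (0 : ℝ) ≤ m := m.cast_nonneg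
        linarith)
  have h2 : ∫ r in Ioi (0 : ℝ), (r : ℂ) ^ m * Complex.exp (-(r : ℂ) ^ 2) =
      ((∫ r in Ioi (0 : ℝ), r ^ (m : ℝ) * Real.exp (-r ^ (2 : ℝ)) : ℝ) : ℂ) := by
    rw [← integral_complex_ofReal]
    refine integral_congr_ae (.of_forall fun r => ?_)
    simp [← Complex.ofReal_pow]
  rw [h2, h]
  push_cast [← Complex.Gamma_ofReal]
  ring_nf

/-- A Gaussian times a form of degree k separates in polar coordinates, and its radial factor is a
Gamma integral. -/
theorem sphereMoment_mul_Gamma {n : ℕ} (hn : 1 ≤ n) (x : Fin n → ℂ) (k : ℕ) :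
    sphereMoment x k * (Complex.Gamma (((n + k : ℕ) : ℂ) / 2) / 2) =
      ∫ ξ : EuclideanSpace ℝ (Fin n), Complex.exp (-(‖ξ‖ : ℂ) ^ 2) * linearForm x ξ ^ k := by
  have : Nontrivial (EuclideanSpace ℝ (Fin n)) :=
    Module.nontrivial_of_finrank_pos (R := ℝ) (by simpa using Nat.pos_of_ne_zero (by omega))
  rw [integral_eq_sphere_mul_Ioi volume (a := fun ω => linearForm x ω ^ k)
    (b := fun r => (r : ℂ) ^ k * Complex.exp (-(r : ℂ) ^ 2)), sphereMoment]
  · congr 1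
    have h := integral_Ioi_pow_mul_gaussian (n - 1 + k)
    rw [show n - 1 + k + 1 = n + k by omega] at h
    rw [← h]
    congr 1
    ext r
    simp
    ring
  · intro ω r hr
    rw [linearForm_smul, norm_smul, norm_eq_of_mem_sphere, Real.norm_of_nonneg hr.le]
    push_cast
    ring_nf

theorem eq_of_hasSum_pow_mul {a b : ℕ → ℂ} {f : ℂ → ℂ}
    (ha : ∀ τ, HasSum (fun k => τ ^ k * a k) (f τ))
    (hb : ∀ τ, HasSum (fun k => τ ^ k * b k) (f τ)) : a = b := by
  have h : ∀ c : ℕ → ℂ, (∀ τ, HasSum (fun k => τ ^ k * c k) (f τ)) →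
      HasFPowerSeriesAt f (FormalMultilinearSeries.ofScalars ℂ c) 0 := fun c hc => by
    rw [hasFPowerSeriesAt_iff]
    refine .of_forall fun τ => ?_
    simpa using hc τ
  have := (h a ha).eq_formalMultilinearSeries (h b hb)
  ext k
  have := congrArg (fun p => FormalMultilinearSeries.coeff p k) this
  simpa using this

/-- The Gaussian transform π^{n/2} exp(τ² x²/4) is expanded in τ in two ways: through the sphere
moments, and through the exponential series, which has even powers only. Coefficients are compared.
-/
theorem sphereMoment_odd_and_even {n : ℕ} (hn : 1 ≤ n) (x : Fin n → ℂ) (k : ℕ) :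
    sphereMoment x (2 * k + 1) = 0 ∧
    sphereMoment x (2 * k) * Complex.Gamma ((k : ℂ) + (n : ℂ) / 2) =
      2 * (Real.pi : ℂ) ^ ((n : ℂ) / 2) * ((2 * k).factorial : ℂ) / (k.factorial : ℂ) *
        ((∑ j, x j ^ 2) / 4) ^ k := by
  set A := ∑ j, x j ^ 2 with hA
  have h1 : ∀ τ : ℂ, HasSum (fun k : ℕ => τ ^ k * ((k.factorial : ℂ)⁻¹ *
      (sphereMoment x k * (Complex.Gamma (((n + k : ℕ) : ℂ) / 2) / 2))))
      ((Real.pi : ℂ) ^ ((n : ℂ) / 2) * Complex.exp (τ ^ 2 * A / 4)) := fun τ => by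
    refine (hasSum_gaussian_moment x τ).congr_fun fun k => ?_
    rw [sphereMoment_mul_Gamma hn]
    ring
  have h2 : ∀ τ : ℂ, HasSum (fun k : ℕ => τ ^ k * (if Even k then
      (Real.pi : ℂ) ^ ((n : ℂ) / 2) * ((A / 4) ^ (k / 2) / ((k / 2).factorial : ℂ)) else 0))
      ((Real.pi : ℂ) ^ ((n : ℂ) / 2) * Complex.exp (τ ^ 2 * A / 4)) := fun τ => by
    have hinj : Function.Injective fun k : ℕ => 2 * k := fun a b h => by simpa using h
    rw [← hinj.hasSum_iff]
    · have := NormedSpace.expSeries_div_hasSum_exp (τ ^ 2 * A / 4)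
      rw [← Complex.exp_eq_exp_ℂ] at this
      refine (this.mul_left ((Real.pi : ℂ) ^ ((n : ℂ) / 2))).congr_fun fun k => ?_
      simp [mul_pow, div_pow, pow_mul]
      ring
    · intro m hm
      have : ¬ Even m := fun ⟨r, hr⟩ => hm ⟨r, by simp only; omega⟩
      simp [this]
  have h3 := eq_of_hasSum_pow_mul h1 h2
  constructor
  · have h := congrFun h3 (2 * k + 1)
    have hG : Complex.Gamma (((n + (2 * k + 1) : ℕ) : ℂ) / 2) ≠ 0 := by
      apply Complex.Gamma_ne_zero_of_re_pos
      simp only [Complex.div_ofNat_re, Complex.natCast_re]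
      positivity
    push_cast at hG
    simpa [Nat.factorial_ne_zero, hG] using h
  · have h := congrFun h3 (2 * k)
    have hf : ((2 * k).factorial : ℂ) ≠ 0 := by exact_mod_cast (2 * k).factorial_ne_zero
    rw [show (((n + 2 * k : ℕ) : ℂ) / 2) = (k : ℂ) + (n : ℂ) / 2 by push_cast; ring] at h
    simp at h
    field_simp at h ⊢
    linear_combination h

/-- In the exponential series the odd moments drop out, and the (2k)! in the even moments cancels
the one in (ir)^{2k}/(2k)!. -/
theorem integral_sphere_exp {n : ℕ} (hn : 1 ≤ n) (x : Fin n → ℂ) (r : ℝ) :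
    ∫ ω : Metric.sphere (0 : EuclideanSpace ℝ (Fin n)) 1,
        Complex.exp (Complex.I * linearForm x (r • ω.1)) ∂volume.toSphere =
      2 * (Real.pi : ℂ) ^ ((n : ℂ) / 2) *
        ∑' k, seriesTerm n ((∑ j, x j ^ 2) * (r : ℂ) ^ 2) k := by
  have h := hasSum_sphereMoment x (Complex.I * r)
  simp only [linearForm_smul, ← mul_assoc]
  refine h.unique ?_
  have hinj : Function.Injective fun k : ℕ => 2 * k := fun a b h => by simpa using h
  rw [← hinj.hasSum_iff]
  · refine ((summable_seriesTerm n _).hasSum.mul_left _).congr_fun fun k => ?_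
    have hG : Complex.Gamma ((k : ℂ) + (n : ℂ) / 2) ≠ 0 := by
      apply Complex.Gamma_ne_zero_of_re_pos
      simp only [Complex.add_re, Complex.div_ofNat_re, Complex.natCast_re]
      positivity
    have hf : ((2 * k).factorial : ℂ) ≠ 0 := by exact_mod_cast (2 * k).factorial_ne_zero
    have hf' : (k.factorial : ℂ) ≠ 0 := by exact_mod_cast k.factorial_ne_zero
    have h := (sphereMoment_odd_and_even hn x k).2
    rw [← eq_div_iff hG] at h
    simp only [Function.comp, seriesTerm]
    rw [h, mul_pow Complex.I, pow_mul Complex.I, Complex.I_sq, neg_div, neg_pow (_ / _),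
      mul_div_assoc, div_pow, div_pow, mul_pow (∑ j, x j ^ 2)]
    field_simp
    ring
  · intro m hm
    have : ¬ Even m := fun ⟨r, hr⟩ => hm ⟨r, by simp only; omega⟩
    obtain ⟨k, hk⟩ := Nat.not_even_iff_odd.1 this
    rw [hk, (sphereMoment_odd_and_even hn x k).1, mul_zero]

/-- Integration of a plane wave against a radial function. -/
theorem integral_exp_mul_radial {n : ℕ} (hn : 1 ≤ n) (x : Fin n → ℂ) (g : ℝ → ℂ)
    (hg : Integrable fun ξ : EuclideanSpace ℝ (Fin n) =>
      Complex.exp (Complex.I * linearForm x ξ) * g ‖ξ‖) :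
    ∫ ξ : EuclideanSpace ℝ (Fin n), Complex.exp (Complex.I * linearForm x ξ) * g ‖ξ‖ =
      2 * (Real.pi : ℂ) ^ ((n : ℂ) / 2) * ∫ r in Ioi (0 : ℝ), (r : ℂ) ^ (n - 1) *
        (∑' k, seriesTerm n ((∑ j, x j ^ 2) * (r : ℂ) ^ 2) k) * g r := by
  have : Nontrivial (EuclideanSpace ℝ (Fin n)) :=
    Module.nontrivial_of_finrank_pos (R := ℝ) (by simpa using Nat.pos_of_ne_zero (by omega))
  rw [integral_eq_integral_Ioi_sphere volume hg, ← integral_const_mul]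
  refine setIntegral_congr_fun measurableSet_Ioi fun r hr => ?_
  simp only [norm_smul, norm_eq_of_mem_sphere, mul_one, Real.norm_of_nonneg (le_of_lt hr)]
  rw [integral_mul_const, integral_sphere_exp hn, finrank_euclideanSpace_fin]
  ring

/-! ### The Bessel-type series on Banach algebras of continuous functions. -/

/-- The sum of the series defining `E`, without the prefactor. -/
def besselSum (d : ℕ) (w : ℂ) : ℂ := ∑' k : ℕ, seriesTerm d w k

theorem seriesTerm_eq_mul_pow (d : ℕ) (w : ℂ) (k : ℕ) :
    seriesTerm d w k = seriesTerm d 1 k * w ^ k := by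
  rw [seriesTerm, seriesTerm, show -w / 4 = -1 / 4 * w by ring, mul_pow]
  ring

section Lift

variable {A : Type*} [NormedCommRing A] [NormedAlgebra ℂ A]

theorem radius_ofScalars_seriesTerm (d : ℕ) :
    (FormalMultilinearSeries.ofScalars A (seriesTerm d 1)).radius = ⊤ := by
  refine FormalMultilinearSeries.radius_eq_top_of_summable_norm _ fun r => ?_
  refine Summable.of_norm_bounded_eventually_nat (summable_seriesTerm d (r : ℝ)).norm ?_
  -- Degree 0 is excluded because the norm of the unit of `A` need not be 1.
  filter_upwards [eventually_gt_atTop 0] with n hn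
  rw [seriesTerm_eq_mul_pow, norm_mul (seriesTerm d 1 n), norm_pow (((r : ℝ)) : ℂ), norm_mul,
    norm_norm, norm_pow, Complex.norm_real]
  gcongr
  exact FormalMultilinearSeries.ofScalars_norm_le A _ n hn

theorem analyticOnNhd_ofScalars_seriesTerm [CompleteSpace A] (d : ℕ) :
    AnalyticOnNhd ℂ (FormalMultilinearSeries.ofScalars A (seriesTerm d 1)).sum univ := by
  have h := (FormalMultilinearSeries.ofScalars A (seriesTerm d 1)).hasFPowerSeriesOnBall
    (by rw [radius_ofScalars_seriesTerm]; exact ENNReal.zero_lt_top)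
  rw [radius_ofScalars_seriesTerm] at h
  simpa using h.analyticOnNhd

theorem hasSum_ofScalars_seriesTerm [CompleteSpace A] (d : ℕ) (a : A) :
    HasSum (fun k => seriesTerm d 1 k • a ^ k)
      ((FormalMultilinearSeries.ofScalars A (seriesTerm d 1)).sum a) := by
  have h := (FormalMultilinearSeries.ofScalars A (seriesTerm d 1)).hasSum (x := a)
    (by rw [radius_ofScalars_seriesTerm]; simp)
  simpa [FormalMultilinearSeries.ofScalars_apply_eq] using h

end Lift

theorem analyticOnNhd_besselSum (d : ℕ) : AnalyticOnNhd ℂ (besselSum d) univ := by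
  have h : besselSum d = (FormalMultilinearSeries.ofScalars ℂ (seriesTerm d 1)).sum := by
    ext w
    rw [← (hasSum_ofScalars_seriesTerm d w).tsum_eq, besselSum]
    simp only [seriesTerm_eq_mul_pow d w, smul_eq_mul]
  rw [h]
  exact analyticOnNhd_ofScalars_seriesTerm d

theorem differentiable_besselSum (d : ℕ) : Differentiable ℂ (besselSum d) := fun w =>
  (analyticOnNhd_besselSum d w trivial).differentiableAt

@[fun_prop]
theorem continuous_besselSum (d : ℕ) : Continuous (besselSum d) :=
  (differentiable_besselSum d).continuous

section ContinuousMap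

variable {K : Type*} [TopologicalSpace K]

theorem ringInverse_apply (f : C(K, ℂ)) (h0 : ∀ k, f k ≠ 0) (k : K) :
    Ring.inverse f k = (f k)⁻¹ := by
  have h := Ring.mul_inverse_cancel f ((ContinuousMap.isUnit_iff_forall_ne_zero f).2 h0)
  have h2 := DFunLike.congr_fun h k
  exact eq_inv_of_mul_eq_one_right h2

variable [CompactSpace K]

/-- Composition with the entire function `besselSum d` on the Banach algebra `C(K, ℂ)`. -/
def besselComp (d : ℕ) (f : C(K, ℂ)) : C(K, ℂ) := ⟨fun k => besselSum d (f k), by fun_prop⟩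

/-- The power series converges everywhere in the algebra `C(K, ℂ)` itself, and evaluation at a
point, being continuous and multiplicative, identifies its sum with pointwise composition. -/
theorem analyticOnNhd_besselComp (d : ℕ) : AnalyticOnNhd ℂ (besselComp (K := K) d) univ := by
  have h : besselComp (K := K) d =
      (FormalMultilinearSeries.ofScalars C(K, ℂ) (seriesTerm d 1)).sum := by
    ext f k
    have h := (hasSum_ofScalars_seriesTerm d f).map (ContinuousMap.evalCLM ℂ k)
      (ContinuousMap.evalCLM ℂ k).continuous
    have h2 := h.tsum_eq
    simp only [Function.comp_def, ContinuousMap.evalCLM_apply, ContinuousMap.smul_apply,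
      ContinuousMap.pow_apply, smul_eq_mul, ← seriesTerm_eq_mul_pow] at h2
    exact h2
  rw [h]
  exact analyticOnNhd_ofScalars_seriesTerm d

theorem analyticAt_ringInverse {X : Type*} [NormedAddCommGroup X] [NormedSpace ℂ X]
    {f : X → C(K, ℂ)} {x : X} (hf : AnalyticAt ℂ f x) (h0 : ∀ k, f x k ≠ 0) :
    AnalyticAt ℂ (fun y => Ring.inverse (f y)) x := by
  obtain ⟨u, hu⟩ := (ContinuousMap.isUnit_iff_forall_ne_zero (f x)).2 h0
  have h := analyticAt_inverse (𝕜 := ℂ) u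
  rw [hu] at h
  exact h.comp hf

variable [MeasurableSpace K] [OpensMeasurableSpace K]

/-- Integration of continuous functions as a continuous linear functional. -/
def integralFunctional (ν : Measure K) [IsFiniteMeasure ν] : C(K, ℂ) →L[ℂ] ℂ :=
  LinearMap.mkContinuous
    { toFun := fun f => ∫ k, f k ∂ν
      map_add' := fun f g => integral_add
        (f.continuous.integrable_of_hasCompactSupport (.of_compactSpace _))
        (g.continuous.integrable_of_hasCompactSupport (.of_compactSpace _))
      map_smul' := fun c f => integral_const_mul c _ } (ν.real univ)
    fun f => by
      refine (norm_integral_le_of_norm_le_const (.of_forall fun k => f.norm_coe_le_norm k)).trans ?_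
      rw [mul_comm]

theorem integralFunctional_apply (ν : Measure K) [IsFiniteMeasure ν] (f : C(K, ℂ)) :
    integralFunctional ν f = ∫ k, f k ∂ν := rfl

end ContinuousMap

/-! ### Cauchy's formula and one-dimensional resolvent integrals. -/

section Cauchy

open Complex

theorem integral_circleMap_cauchy {G : ℂ → ℂ} (hG : Differentiable ℂ G) {ρ : ℝ} {ζ : ℂ}
    (hζ : ‖ζ‖ < ρ) :
    ∫ φ in (0 : ℝ)..2 * Real.pi, circleMap 0 ρ φ * G (circleMap 0 ρ φ) / (circleMap 0 ρ φ - ζ) =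
      2 * Real.pi * G ζ := by
  have h := (hG.differentiableOn (s := Metric.closedBall 0 ρ)).circleIntegral_sub_inv_smul
    (w := ζ) (by simpa using hζ)
  rw [circleIntegral] at h
  simp only [deriv_circleMap, smul_eq_mul] at h
  have hI : I ≠ 0 := I_ne_zero
  apply mul_left_cancel₀ hI
  rw [← intervalIntegral.integral_const_mul]
  linear_combination (exp := 1) h +
    (intervalIntegral.integral_congr (μ := volume) (a := 0) (b := 2 * Real.pi)
      (f := fun φ => I * (circleMap 0 ρ φ * G (circleMap 0 ρ φ) / (circleMap 0 ρ φ - ζ)))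
      (g := fun φ => circleMap 0 ρ φ * I * ((circleMap 0 ρ φ - ζ)⁻¹ * G (circleMap 0 ρ φ)))
      fun φ _ => by ring)

theorem circleMap_sub_ne_zero {ρ : ℝ} {ζ : ℂ} (hζ : ‖ζ‖ < ρ) (φ : ℝ) :
    circleMap 0 ρ φ - ζ ≠ 0 := by
  intro h
  have := congrArg norm (sub_eq_zero.1 h)
  rw [norm_circleMap_zero, abs_of_pos ((norm_nonneg _).trans_lt hζ)] at this
  exact hζ.ne' this

/-- Partial fractions of 1/((w - ζ)(w - τ)) reduce this to two Cauchy formulas. The difference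
quotient is thereby expressed through values of `G` on the circle alone. -/
theorem integral_circleMap_cauchy_slope {G : ℂ → ℂ} (hG : Differentiable ℂ G) {ρ : ℝ} {ζ τ : ℂ}
    (hζ : ‖ζ‖ < ρ) (hτ : ‖τ‖ < ρ) (hne : τ ≠ ζ) :
    ∫ φ in (0 : ℝ)..2 * Real.pi, circleMap 0 ρ φ * G (circleMap 0 ρ φ) / (circleMap 0 ρ φ - ζ) *
      (1 / (circleMap 0 ρ φ - τ)) = 2 * Real.pi * ((G τ - G ζ) / (τ - ζ)) := by
  have hc : ∀ η : ℂ, ‖η‖ < ρ → IntervalIntegrable (fun φ => circleMap 0 ρ φ *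
      G (circleMap 0 ρ φ) / (circleMap 0 ρ φ - η)) volume 0 (2 * Real.pi) := fun η hη => by
    have := hG.continuous
    have := continuous_circleMap 0 ρ
    exact (Continuous.div (by fun_prop) (by fun_prop)
      (circleMap_sub_ne_zero hη)).intervalIntegrable _ _
  have hsub : τ - ζ ≠ 0 := sub_ne_zero.2 hne
  rw [mul_div_assoc', eq_div_iff hsub, mul_sub (2 * (Real.pi : ℂ)),
    ← integral_circleMap_cauchy hG hζ, ← integral_circleMap_cauchy hG hτ,
    ← intervalIntegral.integral_sub (hc τ hτ) (hc ζ hζ),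
    ← intervalIntegral.integral_mul_const]
  refine intervalIntegral.integral_congr fun φ _ => ?_
  have h1 := circleMap_sub_ne_zero hζ φ
  have h2 := circleMap_sub_ne_zero hτ φ
  field_simp
  ring

end Cauchy

open Complex

/-- Splitting of a one-dimensional resolvent integral into a singular part and a regular part that
extends analytically in `ζ`. -/
theorem integral_resolvent_eq {G : ℂ → ℂ} (hG : Differentiable ℂ G) {γ ρ : ℝ} (hγ : 0 < γ)
    (hρ : γ ^ 2 < ρ) (ε : ℕ) {ζ s : ℂ} {r : ℝ → ℂ} (hr : ContinuousOn r (Icc 0 γ))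
    (hζ : ‖ζ‖ < ρ) (hne : ∀ t : ℝ, (t : ℂ) ^ 2 ≠ ζ)
    (hs : ∫ t in (0 : ℝ)..γ, (t : ℂ) ^ ε / ((t : ℂ) ^ 2 - ζ) = s + ∫ t in (0 : ℝ)..γ, r t) :
    ∫ t in (0 : ℝ)..γ, (t : ℂ) ^ ε * G ((t : ℂ) ^ 2) / ((t : ℂ) ^ 2 - ζ) =
      s * G ζ + ∫ t in (0 : ℝ)..γ, ∫ φ in (0 : ℝ)..2 * Real.pi,
        (2 * Real.pi : ℂ)⁻¹ * (circleMap 0 ρ φ * G (circleMap 0 ρ φ) / (circleMap 0 ρ φ - ζ)) *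
          ((t : ℂ) ^ ε * (1 / (circleMap 0 ρ φ - (t : ℂ) ^ 2)) + r t) := by
  have hGc := hG.continuous
  have hsub : ∀ t : ℝ, (t : ℂ) ^ 2 - ζ ≠ 0 := fun t => sub_ne_zero.2 (hne t)
  have hpi : (2 * Real.pi : ℂ) ≠ 0 := by exact_mod_cast Real.two_pi_pos.ne'
  have hri : IntervalIntegrable r volume 0 γ := by
    apply ContinuousOn.intervalIntegrable
    rwa [uIcc_of_le hγ.le]
  -- The Cauchy kernel paired with 1/(w - t²) gives the difference quotient of `G`, and paired with
  -- the constant `r t` it gives `G ζ * r t`.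
  have hinner : ∀ t ∈ uIcc 0 γ, ∫ φ in (0 : ℝ)..2 * Real.pi,
        (2 * Real.pi : ℂ)⁻¹ * (circleMap 0 ρ φ * G (circleMap 0 ρ φ) / (circleMap 0 ρ φ - ζ)) *
          ((t : ℂ) ^ ε * (1 / (circleMap 0 ρ φ - (t : ℂ) ^ 2)) + r t) =
      ((t : ℂ) ^ ε * G ((t : ℂ) ^ 2) / ((t : ℂ) ^ 2 - ζ) -
        G ζ * ((t : ℂ) ^ ε / ((t : ℂ) ^ 2 - ζ))) + G ζ * r t := by
    intro t ht
    rw [uIcc_of_le hγ.le] at ht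
    have hτ : ‖(t : ℂ) ^ 2‖ < ρ := by
      rw [norm_pow, norm_real, Real.norm_of_nonneg ht.1]
      exact (pow_le_pow_left₀ ht.1 ht.2 2).trans_lt hρ
    have hc := continuous_circleMap 0 ρ
    have h1 : IntervalIntegrable (fun φ => circleMap 0 ρ φ * G (circleMap 0 ρ φ) /
        (circleMap 0 ρ φ - ζ)) volume 0 (2 * Real.pi) :=
      (Continuous.div (by fun_prop) (by fun_prop)
        (circleMap_sub_ne_zero hζ)).intervalIntegrable _ _
    have h2 : IntervalIntegrable (fun φ => circleMap 0 ρ φ * G (circleMap 0 ρ φ) /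
        (circleMap 0 ρ φ - ζ) * (1 / (circleMap 0 ρ φ - (t : ℂ) ^ 2))) volume 0 (2 * Real.pi) :=
      ((Continuous.div (by fun_prop) (by fun_prop) (circleMap_sub_ne_zero hζ)).mul
        (Continuous.div (by fun_prop) (by fun_prop)
          (circleMap_sub_ne_zero hτ))).intervalIntegrable _ _
    have h3 := integral_circleMap_cauchy hG hζ
    have h4 := integral_circleMap_cauchy_slope hG hζ hτ (hne t)
    calc _ = ∫ φ in (0 : ℝ)..2 * Real.pi, ((2 * Real.pi : ℂ)⁻¹ * (t : ℂ) ^ ε *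
            (circleMap 0 ρ φ * G (circleMap 0 ρ φ) / (circleMap 0 ρ φ - ζ) *
              (1 / (circleMap 0 ρ φ - (t : ℂ) ^ 2))) + (2 * Real.pi : ℂ)⁻¹ * r t *
            (circleMap 0 ρ φ * G (circleMap 0 ρ φ) / (circleMap 0 ρ φ - ζ))) :=
          intervalIntegral.integral_congr fun φ _ => by ring
      _ = _ := by
          rw [intervalIntegral.integral_add (h2.const_mul _) (h1.const_mul _),
            intervalIntegral.integral_const_mul, intervalIntegral.integral_const_mul, h3, h4]
          have := hsub t
          field_simp
  have i1 : IntervalIntegrable (fun t : ℝ => (t : ℂ) ^ ε * G ((t : ℂ) ^ 2) / ((t : ℂ) ^ 2 - ζ))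
      volume 0 γ :=
    (Continuous.div (by fun_prop) (by fun_prop) hsub).intervalIntegrable _ _
  have i2 : IntervalIntegrable (fun t : ℝ => (t : ℂ) ^ ε / ((t : ℂ) ^ 2 - ζ)) volume 0 γ :=
    (Continuous.div (by fun_prop) (by fun_prop) hsub).intervalIntegrable _ _
  rw [intervalIntegral.integral_congr hinner,
    intervalIntegral.integral_add (i1.sub (i2.const_mul _)) (hri.const_mul _),
    intervalIntegral.integral_sub i1 (i2.const_mul _), intervalIntegral.integral_const_mul,
    intervalIntegral.integral_const_mul, hs]
  ring

/-- If `exp l` is real, the strip forces `l.im = π`, so `exp l` is negative. Hence `exp l` never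
meets the half line [0, ∞). -/
theorem sub_mem_slitPlane {l : ℂ} (h0 : 0 < l.im) (h1 : l.im < 2 * Real.pi) {t : ℝ} (ht : 0 ≤ t) :
    (t : ℂ) - exp l ∈ slitPlane := by
  rw [mem_slitPlane_iff]
  by_cases him : (exp l).im = 0
  · left
    rw [exp_im] at him
    have hs : Real.sin l.im = 0 := (mul_eq_zero.1 him).resolve_left (Real.exp_pos _).ne'
    have hpi : l.im = Real.pi := by
      rcases lt_trichotomy l.im Real.pi with h | h | h
      · exact absurd hs (Real.sin_pos_of_pos_of_lt_pi h0 h).ne'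
      · exact h
      · have := Real.sin_pos_of_pos_of_lt_pi (x := l.im - Real.pi) (by linarith) (by linarith)
        rw [Real.sin_sub_pi] at this
        linarith
    rw [sub_re, ofReal_re, exp_re, hpi, Real.cos_pi]
    have := Real.exp_pos l.re
    linarith
  · right
    simpa using him

theorem re_pow_sub_mul_pos {γ : ℝ} {ζ : ℂ} (hζ : ‖ζ‖ < γ ^ 2) {t : ℝ} (ht : t ∈ Icc 0 γ) :
    0 < ((γ : ℂ) ^ 4 - (t : ℂ) ^ 2 * ζ).re := by
  have h1 : ((t : ℂ) ^ 2 * ζ).re ≤ t ^ 2 * ‖ζ‖ := by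
    refine (re_le_norm _).trans ?_
    rw [norm_mul, norm_pow, norm_real, Real.norm_of_nonneg ht.1]
  have h2 : t ^ 2 ≤ γ ^ 2 := pow_le_pow_left₀ ht.1 ht.2 2
  have h3 := norm_nonneg ζ
  have h4 : ((γ : ℂ) ^ 4).re = γ ^ 4 := by norm_cast
  rw [sub_re, h4]
  nlinarith [sq_nonneg t, mul_le_mul_of_nonneg_right h2 h3,
    mul_lt_mul_of_pos_left hζ (h3.trans_lt hζ)]

/-- The parameter is a logarithm `l` of ζ because ζ = z e^{2iθ} may cross the negative axis, where
the principal branch jumps. The last integral comes from the tail over (γ, ∞) by t ↦ γ²/t, with the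
divergent term 1/t removed; it is regular for |ζ| < γ². -/
theorem integral_id_div_sq_sub {γ : ℝ} (hγ : 0 < γ) {l : ℂ} (h0 : 0 < l.im)
    (h1 : l.im < 2 * Real.pi) (hl : ‖exp l‖ < γ ^ 2) :
    ∫ t in (0 : ℝ)..γ, (t : ℂ) / ((t : ℂ) ^ 2 - exp l) =
      -(1 / 2) * l + Real.log γ + Real.pi * I / 2 -
        ∫ t in (0 : ℝ)..γ, (t : ℂ) * exp l / ((γ : ℂ) ^ 4 - (t : ℂ) ^ 2 * exp l) := by
  have hγ' : (γ : ℂ) ≠ 0 := by exact_mod_cast hγ.ne'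
  have hmem : ∀ t : ℝ, (t : ℂ) ^ 2 - exp l ∈ slitPlane := fun t => by
    have := sub_mem_slitPlane h0 h1 (sq_nonneg t)
    rwa [ofReal_pow] at this
  have hne : ∀ t : ℝ, (t : ℂ) ^ 2 - exp l ≠ 0 := fun t => slitPlane_ne_zero (hmem t)
  have hne' : ∀ t ∈ uIcc 0 γ, (γ : ℂ) ^ 4 - (t : ℂ) ^ 2 * exp l ≠ 0 := fun t ht h => by
    rw [uIcc_of_le hγ.le] at ht
    have := re_pow_sub_mul_pos hl ht
    simp [h] at this
  have hd : ∀ t : ℝ, HasDerivAt (fun t : ℝ => (t : ℂ)) 1 t := fun t =>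
    (hasDerivAt_id t).ofReal_comp
  have e1 : ∫ t in (0 : ℝ)..γ, (t : ℂ) / ((t : ℂ) ^ 2 - exp l) =
      log ((γ : ℂ) ^ 2 - exp l) / 2 - log (-exp l) / 2 := by
    have := intervalIntegral.integral_eq_sub_of_hasDerivAt (a := 0) (b := γ)
      (f := fun t : ℝ => log ((t : ℂ) ^ 2 - exp l) / 2)
      (f' := fun t : ℝ => (t : ℂ) / ((t : ℂ) ^ 2 - exp l)) (fun t _ => by
        refine (((((hd t).pow 2).sub_const (exp l)).clog_real (hmem t)).div_const 2).congr_deriv ?_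
        have := hne t
        simp
        field_simp) ((Continuous.div (by fun_prop) (by fun_prop) hne).intervalIntegrable _ _)
    simpa using this
  have e2 : ∫ t in (0 : ℝ)..γ, (t : ℂ) * exp l / ((γ : ℂ) ^ 4 - (t : ℂ) ^ 2 * exp l) =
      Real.log γ - log ((γ : ℂ) ^ 2 - exp l) / 2 := by
    have := intervalIntegral.integral_eq_sub_of_hasDerivAt (a := 0) (b := γ)
      (f := fun t : ℝ => -(log ((γ : ℂ) ^ 2 - (t : ℂ) ^ 2 * exp l / (γ : ℂ) ^ 2) / 2))
      (f' := fun t : ℝ => (t : ℂ) * exp l / ((γ : ℂ) ^ 4 - (t : ℂ) ^ 2 * exp l)) (fun t ht => by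
        have ht' := ht
        rw [uIcc_of_le hγ.le] at ht'
        have hq : (γ : ℂ) ^ 2 - (t : ℂ) ^ 2 * exp l / (γ : ℂ) ^ 2 =
            ((γ ^ 2)⁻¹ : ℝ) * ((γ : ℂ) ^ 4 - (t : ℂ) ^ 2 * exp l) := by
          push_cast
          field_simp
        have hs : (γ : ℂ) ^ 2 - (t : ℂ) ^ 2 * exp l / (γ : ℂ) ^ 2 ∈ slitPlane := by
          rw [mem_slitPlane_iff, hq, re_ofReal_mul]
          exact .inl (mul_pos (by positivity) (re_pow_sub_mul_pos hl ht'))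
        refine ((((((((hd t).pow 2).mul_const (exp l)).div_const ((γ : ℂ) ^ 2)).const_sub
          ((γ : ℂ) ^ 2)).clog_real hs).div_const 2).neg).congr_deriv ?_
        have := hne' t ht
        simp only [Pi.pow_apply]
        rw [hq]
        push_cast
        field_simp) (ContinuousOn.intervalIntegrable
          (ContinuousOn.div (by fun_prop) (by fun_prop) hne'))
    rw [this]
    have hg : log ((γ : ℂ) ^ 2) = 2 * Real.log γ := by
      rw [← ofReal_pow, ← ofReal_log (by positivity), Real.log_pow]
      push_cast
      ring
    have hg2 : (γ : ℂ) ^ 2 * exp l / (γ : ℂ) ^ 2 = exp l := by field_simp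
    rw [hg2]
    simp [hg]
    ring
  -- The shift by π puts the imaginary part into (-π, π), where the principal logarithm inverts the
  -- exponential.
  have e3 : log (-exp l) = l - Real.pi * I := by
    rw [← exp_sub_pi_mul_I, log_exp]
    · simp
      linarith
    · simp
      linarith
  rw [e1, e2, e3]
  ring

/-- The integral over (0, ∞) is iπ/(2σ) when Im σ > 0; the subtracted term is the tail over (γ, ∞)
after t ↦ γ²/t, and it is regular for |σ²| < γ². -/
theorem integral_one_div_sq_sub {γ : ℝ} (hγ : 0 < γ) {σ : ℂ} (h0 : 0 < σ.im)
    (hl : ‖σ ^ 2‖ < γ ^ 2) :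
    ∫ t in (0 : ℝ)..γ, 1 / ((t : ℂ) ^ 2 - σ ^ 2) =
      I * Real.pi / (2 * σ) -
        ∫ t in (0 : ℝ)..γ, (γ : ℂ) ^ 2 / ((γ : ℂ) ^ 4 - (t : ℂ) ^ 2 * σ ^ 2) := by
  have hγ' : (γ : ℂ) ≠ 0 := by exact_mod_cast hγ.ne'
  have hσ : σ ≠ 0 := fun h => by simp [h] at h0
  have hσn : ‖σ‖ < γ := by
    rw [norm_pow] at hl
    exact lt_of_pow_lt_pow_left₀ 2 hγ.le hl
  have m1 : ∀ t : ℝ, σ - t ∈ slitPlane := fun t => .inr (by simpa using h0.ne')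
  have m2 : ∀ t : ℝ, σ + t ∈ slitPlane := fun t => .inr (by simpa using h0.ne')
  have n1 : ∀ t : ℝ, σ - t ≠ 0 := fun t => slitPlane_ne_zero (m1 t)
  have n2 : ∀ t : ℝ, σ + t ≠ 0 := fun t => slitPlane_ne_zero (m2 t)
  have hne : ∀ t : ℝ, (t : ℂ) ^ 2 - σ ^ 2 ≠ 0 := fun t => by
    rw [show (t : ℂ) ^ 2 - σ ^ 2 = -((σ - t) * (σ + t)) by ring]
    exact neg_ne_zero.2 (mul_ne_zero (n1 t) (n2 t))
  have hd : ∀ t : ℝ, HasDerivAt (fun t : ℝ => (t : ℂ)) 1 t := fun t =>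
    (hasDerivAt_id t).ofReal_comp
  have e1 : ∫ t in (0 : ℝ)..γ, 1 / ((t : ℂ) ^ 2 - σ ^ 2) =
      (log (σ - γ) - log (σ + γ)) / (2 * σ) := by
    have := intervalIntegral.integral_eq_sub_of_hasDerivAt (a := 0) (b := γ)
      (f := fun t : ℝ => (log (σ - t) - log (σ + t)) / (2 * σ))
      (f' := fun t : ℝ => 1 / ((t : ℂ) ^ 2 - σ ^ 2)) (fun t _ => by
        refine (((((hd t).const_sub σ).clog_real (m1 t)).sub
          (((hd t).const_add σ).clog_real (m2 t))).div_const (2 * σ)).congr_deriv ?_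
        have := n1 t
        have := n2 t
        rw [show (t : ℂ) ^ 2 - σ ^ 2 = -((σ - t) * (σ + t)) by ring]
        field_simp
        ring) ((Continuous.div (by fun_prop) (by fun_prop) hne).intervalIntegrable _ _)
    simpa using this
  have hb : ∀ t ∈ Icc 0 γ, ‖(t : ℂ) * σ / γ‖ < γ := fun t ht => by
    rw [norm_div, norm_mul, norm_real, norm_real, Real.norm_of_nonneg ht.1,
      Real.norm_of_nonneg hγ.le, div_lt_iff₀ hγ]
    nlinarith [ht.1, ht.2, norm_nonneg σ]
  have m3 : ∀ t ∈ Icc 0 γ, (γ : ℂ) - t * σ / γ ∈ slitPlane := fun t ht => .inl (by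
    rw [sub_re, ofReal_re]
    linarith [(re_le_norm ((t : ℂ) * σ / γ)), hb t ht])
  have m4 : ∀ t ∈ Icc 0 γ, (γ : ℂ) + t * σ / γ ∈ slitPlane := fun t ht => .inl (by
    rw [add_re, ofReal_re]
    linarith [neg_le_of_abs_le (abs_re_le_norm ((t : ℂ) * σ / γ)), hb t ht])
  have hfac : ∀ t : ℝ, (γ : ℂ) ^ 4 - (t : ℂ) ^ 2 * σ ^ 2 =
      (γ : ℂ) ^ 2 * (((γ : ℂ) - t * σ / γ) * ((γ : ℂ) + t * σ / γ)) := fun t => by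
    field_simp
    ring
  have hne' : ∀ t ∈ uIcc 0 γ, (γ : ℂ) ^ 4 - (t : ℂ) ^ 2 * σ ^ 2 ≠ 0 := fun t ht => by
    rw [uIcc_of_le hγ.le] at ht
    rw [hfac]
    exact mul_ne_zero (by positivity)
      (mul_ne_zero (slitPlane_ne_zero (m3 t ht)) (slitPlane_ne_zero (m4 t ht)))
  have e2 : ∫ t in (0 : ℝ)..γ, (γ : ℂ) ^ 2 / ((γ : ℂ) ^ 4 - (t : ℂ) ^ 2 * σ ^ 2) =
      (log (γ + σ) - log (γ - σ)) / (2 * σ) := by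
    have := intervalIntegral.integral_eq_sub_of_hasDerivAt (a := 0) (b := γ)
      (f := fun t : ℝ => (log ((γ : ℂ) + t * σ / γ) - log ((γ : ℂ) - t * σ / γ)) / (2 * σ))
      (f' := fun t : ℝ => (γ : ℂ) ^ 2 / ((γ : ℂ) ^ 4 - (t : ℂ) ^ 2 * σ ^ 2)) (fun t ht => by
        rw [uIcc_of_le hγ.le] at ht
        refine (((((((hd t).mul_const σ).div_const (γ : ℂ)).const_add (γ : ℂ)).clog_real
          (m4 t ht)).sub (((((hd t).mul_const σ).div_const (γ : ℂ)).const_sub (γ : ℂ)).clog_real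
          (m3 t ht))).div_const (2 * σ)).congr_deriv ?_
        have h3 := slitPlane_ne_zero (m3 t ht)
        have h4 := slitPlane_ne_zero (m4 t ht)
        rw [hfac]
        generalize hu : (γ : ℂ) - t * σ / γ = u at *
        generalize hv : (γ : ℂ) + t * σ / γ = v at *
        have huv : u + v = 2 * γ := by rw [← hu, ← hv]; ring
        field_simp
        linear_combination huv) (ContinuousOn.intervalIntegrable
          (ContinuousOn.div (by fun_prop) (by fun_prop) hne'))
    rw [this]
    have hg2 : (γ : ℂ) * σ / γ = σ := by field_simp
    simp [hg2]
  -- γ - σ lies in the lower half plane, so adding π to its argument stays within the principal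
  -- range.
  have e3 : log (σ - γ) = log (γ - σ) + Real.pi * I := by
    have hne0 : (γ : ℂ) - σ ≠ 0 := by
      rw [← neg_ne_zero, neg_sub]
      exact n1 γ
    have harg : arg (γ - σ) < 0 := arg_neg_iff.2 (by simpa using h0)
    have hx : σ - γ = exp (log (γ - σ) + Real.pi * I) := by
      rw [exp_add_pi_mul_I, exp_log hne0, neg_sub]
    rw [hx, log_exp]
    · simp only [add_im, log_im, mul_im, ofReal_re, I_im, ofReal_im, I_re]
      linarith [neg_pi_lt_arg (γ - σ), Real.pi_pos]
    · simp only [add_im, log_im, mul_im, ofReal_re, I_im, ofReal_im, I_re]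
      linarith
  rw [e1, e2, e3, add_comm σ]
  ring

/-! ### The parameter space and the analytic remainder. -/

/-- The range `[0, π / 2]` of the rotation angle. -/
abbrev Angle : Type := Icc (0 : ℝ) (Real.pi / 2)

/-- The compact parameter space of the regular part of the resolvent kernel. -/
abbrev Param (γ : ℝ) : Type := Angle × Icc (0 : ℝ) γ × Icc (0 : ℝ) (2 * Real.pi)

namespace Param

variable (γ : ℝ)

/-- The rotation factor `e^{2 i θ}`. -/
def rotation : C(Param γ, ℂ) := ⟨fun k => exp (2 * I * (k.1.1 : ℂ)), by fun_prop⟩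

/-- The radial variable. -/
def radius : C(Param γ, ℂ) := ⟨fun k => (k.2.1.1 : ℂ), by fun_prop⟩

/-- The point on the circle of radius `γ ^ 2 + 1`. -/
def circlePoint : C(Param γ, ℂ) := ⟨fun k => circleMap 0 (γ ^ 2 + 1) k.2.2.1, by
  have := continuous_circleMap 0 (γ ^ 2 + 1)
  fun_prop⟩

theorem rotation_apply (k : Param γ) : rotation γ k = exp (2 * I * (k.1.1 : ℂ)) := rfl

theorem radius_apply (k : Param γ) : radius γ k = (k.2.1.1 : ℂ) := rfl

theorem circlePoint_apply (k : Param γ) :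
    circlePoint γ k = circleMap 0 (γ ^ 2 + 1) k.2.2.1 := rfl

theorem norm_rotation_apply (k : Param γ) : ‖rotation γ k‖ = 1 := by
  rw [rotation_apply, norm_exp]
  simp

theorem circlePoint_sub_radius_ne_zero (k : Param γ) :
    (circlePoint γ - radius γ ^ 2) k ≠ 0 := by
  refine circleMap_sub_ne_zero ?_ _
  rw [ContinuousMap.pow_apply, radius_apply, norm_pow, norm_real, Real.norm_of_nonneg k.2.1.2.1]
  linarith [pow_le_pow_left₀ k.2.1.2.1 k.2.1.2.2 2]

end Param

theorem exp_log_add_rotation {z : ℂ} (hz : 0 < z.im) (θ : ℝ) :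
    exp (log z + 2 * I * θ) = z * exp (2 * I * θ) := by
  rw [exp_add, exp_log]
  rintro rfl
  simp at hz

theorem im_log_add_rotation {z : ℂ} (hz : 0 < z.im) (θ : Angle) :
    0 < (log z + 2 * I * (θ.1 : ℂ)).im ∧ (log z + 2 * I * (θ.1 : ℂ)).im < 2 * Real.pi := by
  have h1 : 0 < arg z := by
    rcases (arg_nonneg_iff.2 hz.le).lt_or_eq with h | h
    · exact h
    · exact absurd (arg_eq_zero_iff.1 h.symm).2.symm hz.ne
  have h2 : arg z < Real.pi := by
    rcases (arg_le_pi z).lt_or_eq with h | h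
    · exact h
    · exact absurd (arg_eq_pi_iff.1 h).2.symm hz.ne
  have h3 : (log z + 2 * I * (θ.1 : ℂ)).im = arg z + 2 * θ.1 := by
    simp [log_im]
  rw [h3]
  have := θ.2.1
  have := θ.2.2
  constructor <;> linarith

theorem sq_ne_rotation {z : ℂ} (hz : 0 < z.im) (θ : Angle) (t : ℝ) :
    (t : ℂ) ^ 2 ≠ z * exp (2 * I * (θ.1 : ℂ)) := by
  have h := slitPlane_ne_zero (sub_mem_slitPlane (im_log_add_rotation hz θ).1
    (im_log_add_rotation hz θ).2 (sq_nonneg t))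
  rw [exp_log_add_rotation hz, ofReal_pow] at h
  exact sub_ne_zero.1 h

theorem norm_mul_rotation (z : ℂ) (θ : ℝ) : ‖z * exp (2 * I * (θ : ℂ))‖ = ‖z‖ := by
  rw [norm_mul, norm_exp]
  simp

/-- Lebesgue measure on a compact interval. -/
def volumeIcc (a b : ℝ) : Measure (Icc a b) := volume.comap Subtype.val

instance (a b : ℝ) : IsFiniteMeasure (volumeIcc a b) where
  measure_univ_lt_top := by
    rw [volumeIcc, comap_subtype_coe_apply measurableSet_Icc, image_univ, Subtype.range_coe]
    exact measure_Icc_lt_top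

theorem integral_volumeIcc {a b : ℝ} (hab : a ≤ b) (g : ℝ → ℂ) :
    ∫ t, g t.1 ∂(volumeIcc a b) = ∫ t in a..b, g t := by
  rw [volumeIcc, intervalIntegral.integral_of_le hab, ← integral_Icc_eq_integral_Ioc,
    ← integral_subtype_comap measurableSet_Icc]

theorem integral_prod_prod {A B C : Type*} [TopologicalSpace A] [TopologicalSpace B]
    [TopologicalSpace C] [CompactSpace A] [CompactSpace B] [CompactSpace C]
    [SecondCountableTopology A] [SecondCountableTopology B] [SecondCountableTopology C]
    [MeasurableSpace A] [MeasurableSpace B] [MeasurableSpace C]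
    [OpensMeasurableSpace A] [OpensMeasurableSpace B] [OpensMeasurableSpace C]
    (μ : Measure A) (ν : Measure B) (κ : Measure C) [IsFiniteMeasure μ] [IsFiniteMeasure ν]
    [IsFiniteMeasure κ] (f : C(A × B × C, ℂ)) :
    Integrable (fun a => ∫ b, ∫ c, f (a, b, c) ∂κ ∂ν) μ ∧
    ∫ k, f k ∂(μ.prod (ν.prod κ)) = ∫ a, ∫ b, ∫ c, f (a, b, c) ∂κ ∂ν ∂μ := by
  have hint : Integrable f (μ.prod (ν.prod κ)) :=
    f.continuous.integrable_of_hasCompactSupport (.of_compactSpace _)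
  have hinner : ∀ a, ∫ k, f (a, k) ∂(ν.prod κ) = ∫ b, ∫ c, f (a, b, c) ∂κ ∂ν := fun a =>
    integral_prod _ ((f.continuous.comp (Continuous.prodMk_right a)).integrable_of_hasCompactSupport
      (.of_compactSpace _))
  constructor
  · exact hint.integral_prod_left.congr (.of_forall hinner)
  · rw [integral_prod _ hint]
    exact integral_congr_ae (.of_forall hinner)

/-- The product measure on the parameter space. -/
def Param.measure (γ : ℝ) (μ : Measure Angle) : Measure (Param γ) :=
  μ.prod ((volumeIcc 0 γ).prod (volumeIcc 0 (2 * Real.pi)))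

instance (γ : ℝ) (μ : Measure Angle) [IsFiniteMeasure μ] : IsFiniteMeasure (Param.measure γ μ) := by
  unfold Param.measure
  infer_instance

theorem integral_param {γ : ℝ} (hγ : 0 < γ) (μ : Measure Angle) [IsFiniteMeasure μ]
    (f : C(Param γ, ℂ)) (h : Angle → ℝ → ℝ → ℂ) (hf : ∀ θ t φ, f (θ, t, φ) = h θ t.1 φ.1) :
    Integrable (fun θ => ∫ t in (0 : ℝ)..γ, ∫ φ in (0 : ℝ)..2 * Real.pi, h θ t φ) μ ∧
    ∫ k, f k ∂(Param.measure γ μ) =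
      ∫ θ, (∫ t in (0 : ℝ)..γ, ∫ φ in (0 : ℝ)..2 * Real.pi, h θ t φ) ∂μ := by
  have h1 := integral_prod_prod μ (volumeIcc 0 γ) (volumeIcc 0 (2 * Real.pi)) f
  simp only [hf, integral_volumeIcc Real.two_pi_pos.le] at h1
  have h2 : ∀ θ, ∫ t, (∫ φ in (0 : ℝ)..2 * Real.pi, h θ t.1 φ) ∂(volumeIcc 0 γ) =
      ∫ t in (0 : ℝ)..γ, ∫ φ in (0 : ℝ)..2 * Real.pi, h θ t φ := fun θ =>
    integral_volumeIcc hγ.le fun t => ∫ φ in (0 : ℝ)..2 * Real.pi, h θ t φ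
  simp only [h2] at h1
  refine ⟨h1.1, .trans ?_ h1.2⟩
  exact integral_congr_ae (.of_forall fun k => hf k.1 k.2.1 k.2.2)

/-- The integrand of the regular part. -/
def regularIntegrand {X : Type*} {γ : ℝ} (ε : ℕ) (Gl : X → C(Param γ, ℂ)) (R : ℂ → C(Param γ, ℂ))
    (y : ℂ × X) : C(Param γ, ℂ) :=
  ContinuousMap.const _ (2 * Real.pi : ℂ)⁻¹ * (Param.circlePoint γ * Gl y.2 *
    Ring.inverse (Param.circlePoint γ - y.1 • Param.rotation γ)) *
    (Param.radius γ ^ ε * Ring.inverse (Param.circlePoint γ - Param.radius γ ^ 2) + R y.1)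

theorem circlePoint_sub_smul_rotation_ne_zero {γ : ℝ} {z : ℂ} (hz : ‖z‖ < γ ^ 2) (k : Param γ) :
    (Param.circlePoint γ - z • Param.rotation γ) k ≠ 0 := by
  refine circleMap_sub_ne_zero ?_ _
  rw [ContinuousMap.smul_apply, norm_smul, Param.norm_rotation_apply]
  linarith

theorem analyticOnNhd_regularIntegrand {X : Type*} [NormedAddCommGroup X] [NormedSpace ℂ X] {γ : ℝ}
    (ε : ℕ) {Gl : X → C(Param γ, ℂ)} (hGl : AnalyticOnNhd ℂ Gl univ)
    {R : ℂ → C(Param γ, ℂ)} (hR : AnalyticOnNhd ℂ R (Metric.ball 0 (γ ^ 2))) :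
    AnalyticOnNhd ℂ (regularIntegrand ε Gl R) (Metric.ball 0 (γ ^ 2) ×ˢ univ) := by
  rintro ⟨z, x⟩ ⟨hz, -⟩
  have hz' : ‖z‖ < γ ^ 2 := by simpa using hz
  have h1 : AnalyticAt ℂ (fun y : ℂ × X => Gl y.2) (z, x) :=
    (hGl x trivial).comp_of_eq analyticAt_snd rfl
  have h2 : AnalyticAt ℂ (fun y : ℂ × X => R y.1) (z, x) :=
    (hR z hz).comp_of_eq analyticAt_fst rfl
  have h3 : AnalyticAt ℂ (fun y : ℂ × X => Param.circlePoint γ - y.1 • Param.rotation γ) (z, x) :=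
    analyticAt_const.sub (analyticAt_fst.smul analyticAt_const)
  have h4 := analyticAt_ringInverse h3 (circlePoint_sub_smul_rotation_ne_zero hz')
  exact (analyticAt_const.mul ((analyticAt_const.mul h1).mul h4)).mul (analyticAt_const.add h2)

theorem regularIntegrand_apply {X : Type*} {γ : ℝ} (ε : ℕ) {G : X → Angle → ℂ → ℂ}
    {Gl : X → C(Param γ, ℂ)} (hGeq : ∀ x k, Gl x k = G x k.1 (Param.circlePoint γ k))
    {R : ℂ → C(Param γ, ℂ)} {r : ℂ → Angle → ℝ → ℂ}
    (hRr : ∀ z, ‖z‖ < γ ^ 2 → ∀ k, R z k = r z k.1 k.2.1) {z : ℂ} (hz : ‖z‖ < γ ^ 2) (x : X)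
    (θ : Angle) (t : Icc (0 : ℝ) γ) (φ : Icc (0 : ℝ) (2 * Real.pi)) :
    regularIntegrand ε Gl R (z, x) (θ, t, φ) =
      (2 * Real.pi : ℂ)⁻¹ * (circleMap 0 (γ ^ 2 + 1) φ * G x θ (circleMap 0 (γ ^ 2 + 1) φ) /
        (circleMap 0 (γ ^ 2 + 1) φ - z * exp (2 * I * (θ.1 : ℂ)))) *
          ((t : ℂ) ^ ε * (1 / (circleMap 0 (γ ^ 2 + 1) φ - (t : ℂ) ^ 2)) + r z θ t) := by
  rw [regularIntegrand]
  simp only [ContinuousMap.mul_apply, ContinuousMap.smul_apply, ContinuousMap.add_apply,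
    ContinuousMap.pow_apply, ContinuousMap.const_apply, hRr z hz, hGeq,
    ringInverse_apply _ (circlePoint_sub_smul_rotation_ne_zero hz),
    ringInverse_apply _ (Param.circlePoint_sub_radius_ne_zero γ), ContinuousMap.sub_apply,
    smul_eq_mul, Param.circlePoint_apply, Param.radius_apply, Param.rotation_apply, div_eq_mul_inv,
    one_mul]

/-- The integrand of the remainder is built from inverses and products in `C(Param γ, ℂ)`, where
inversion is analytic at units, and then integrated by a bounded functional. The density enters only
through `Gl`, its values on the circle, so analyticity in `x` is required of `Gl` only. -/
theorem exists_analytic_remainder {X : Type*} [NormedAddCommGroup X] [NormedSpace ℂ X] {γ : ℝ}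
    (hγ : 0 < γ) (ε : ℕ) (μ : Measure Angle) [IsFiniteMeasure μ] {G : X → Angle → ℂ → ℂ}
    (hG : ∀ x θ, Differentiable ℂ (G x θ)) (hGc : ∀ x, Continuous (Function.uncurry (G x)))
    {Gl : X → C(Param γ, ℂ)} (hGl : AnalyticOnNhd ℂ Gl univ)
    (hGeq : ∀ x k, Gl x k = G x k.1 (Param.circlePoint γ k))
    {s : ℂ → Angle → ℂ} (hsc : ∀ z, Continuous (s z))
    {R : ℂ → C(Param γ, ℂ)} (hR : AnalyticOnNhd ℂ R (Metric.ball 0 (γ ^ 2)))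
    {r : ℂ → Angle → ℝ → ℂ} (hr : ∀ z, ‖z‖ < γ ^ 2 → ∀ θ, ContinuousOn (r z θ) (Icc 0 γ))
    (hRr : ∀ z, ‖z‖ < γ ^ 2 → ∀ k, R z k = r z k.1 k.2.1)
    (hs : ∀ z : ℂ, 0 < z.im → ‖z‖ < γ ^ 2 → ∀ θ : Angle,
      ∫ t in (0 : ℝ)..γ, (t : ℂ) ^ ε / ((t : ℂ) ^ 2 - z * exp (2 * I * (θ.1 : ℂ))) =
        s z θ + ∫ t in (0 : ℝ)..γ, r z θ t) :
    ∃ χ : ℂ × X → ℂ, AnalyticOnNhd ℂ χ (Metric.ball 0 (γ ^ 2) ×ˢ univ) ∧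
      ∀ z : ℂ, 0 < z.im → ‖z‖ < γ ^ 2 → ∀ x : X,
        ∫ θ, (∫ t in (0 : ℝ)..γ, (t : ℂ) ^ ε * G x θ ((t : ℂ) ^ 2) /
          ((t : ℂ) ^ 2 - z * exp (2 * I * (θ.1 : ℂ)))) ∂μ =
        ∫ θ, s z θ * G x θ (z * exp (2 * I * (θ.1 : ℂ))) ∂μ + χ (z, x) := by
  refine ⟨fun y => integralFunctional (Param.measure γ μ) (regularIntegrand ε Gl R y),
    fun y hy => (ContinuousLinearMap.analyticAt _ _).comp
      (analyticOnNhd_regularIntegrand ε hGl hR y hy), fun z hz hzn x => ?_⟩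
  obtain ⟨hi, heq⟩ := integral_param hγ μ (regularIntegrand ε Gl R (z, x)) (fun θ t φ =>
      (2 * Real.pi : ℂ)⁻¹ * (circleMap 0 (γ ^ 2 + 1) φ * G x θ (circleMap 0 (γ ^ 2 + 1) φ) /
        (circleMap 0 (γ ^ 2 + 1) φ - z * exp (2 * I * (θ.1 : ℂ)))) *
          ((t : ℂ) ^ ε * (1 / (circleMap 0 (γ ^ 2 + 1) φ - (t : ℂ) ^ 2)) + r z θ t))
    (regularIntegrand_apply ε hGeq hRr hzn x)
  beta_reduce
  rw [integralFunctional_apply, heq, ← integral_add ?_ hi]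
  · refine integral_congr_ae (.of_forall fun θ => ?_)
    exact integral_resolvent_eq (hG x θ) hγ (lt_add_one _) ε (hr z hzn θ)
      (by rw [norm_mul_rotation]; linarith) (sq_ne_rotation hz θ) (hs z hz hzn θ)
  · have h1 := hsc z
    have h2 : Continuous fun θ : Angle => G x θ (z * exp (2 * I * (θ.1 : ℂ))) :=
      (hGc x).comp (f := fun θ : Angle => (θ, z * exp (2 * I * (θ.1 : ℂ)))) (by fun_prop)
    exact (h1.mul h2).integrable_of_hasCompactSupport (.of_compactSpace _)

theorem pow_sub_mul_rotation_re_pos {γ : ℝ} {z : ℂ} (hz : ‖z‖ < γ ^ 2) (θ : ℝ) {t : ℝ}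
    (ht : t ∈ Icc 0 γ) : 0 < ((γ : ℂ) ^ 4 - (t : ℂ) ^ 2 * (z * exp (2 * I * (θ : ℂ)))).re :=
  re_pow_sub_mul_pos (by rwa [norm_mul_rotation]) ht

theorem sqrt_sq {z : ℂ} : Complex.sqrt z ^ 2 = z := by
  rw [Complex.sqrt, ← cpow_nat_mul]
  simp

theorem sqrt_eq_exp {z : ℂ} (hz : z ≠ 0) : Complex.sqrt z = exp (log z / 2) := by
  rw [Complex.sqrt, cpow_def_of_ne_zero hz]
  rfl

/-- The function `1 / (γ ^ 4 - t ^ 2 z e^{2 i θ})` as an analytic function of `z`. -/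
def regularDenominator (γ : ℝ) (z : ℂ) : C(Param γ, ℂ) :=
  Ring.inverse (ContinuousMap.const _ ((γ : ℂ) ^ 4) - z • (Param.radius γ ^ 2 * Param.rotation γ))

theorem regularDenominator_aux {γ : ℝ} {z : ℂ} (hz : ‖z‖ < γ ^ 2) (k : Param γ) :
    (ContinuousMap.const (Param γ) ((γ : ℂ) ^ 4) -
      z • (Param.radius γ ^ 2 * Param.rotation γ)) k ≠ 0 := by
  have h := pow_sub_mul_rotation_re_pos hz k.1.1 k.2.1.2
  intro h0
  have h1 : (γ : ℂ) ^ 4 - (k.2.1.1 : ℂ) ^ 2 * (z * exp (2 * I * (k.1.1 : ℂ))) = 0 := by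
    rw [← h0]
    simp only [ContinuousMap.sub_apply, ContinuousMap.smul_apply, ContinuousMap.mul_apply,
      ContinuousMap.pow_apply, Param.radius_apply, Param.rotation_apply, smul_eq_mul,
      ContinuousMap.const_apply]
    ring
  simp [h1] at h

theorem regularDenominator_apply {γ : ℝ} {z : ℂ} (hz : ‖z‖ < γ ^ 2) (k : Param γ) :
    regularDenominator γ z k =
      ((γ : ℂ) ^ 4 - (k.2.1.1 : ℂ) ^ 2 * (z * exp (2 * I * (k.1.1 : ℂ))))⁻¹ := by
  rw [regularDenominator, ringInverse_apply _ (regularDenominator_aux hz)]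
  simp only [ContinuousMap.sub_apply, ContinuousMap.smul_apply, ContinuousMap.mul_apply,
    ContinuousMap.pow_apply, Param.radius_apply, Param.rotation_apply, smul_eq_mul,
    ContinuousMap.const_apply]
  ring_nf

theorem analyticOnNhd_regularDenominator (γ : ℝ) :
    AnalyticOnNhd ℂ (regularDenominator γ) (Metric.ball 0 (γ ^ 2)) := fun z hz =>
  analyticAt_ringInverse (analyticAt_const.sub (analyticAt_id.smul analyticAt_const))
    (regularDenominator_aux (by simpa using hz))

theorem exists_analytic_remainder_odd {X : Type*} [NormedAddCommGroup X] [NormedSpace ℂ X] {γ : ℝ}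
    (hγ : 0 < γ) (μ : Measure Angle) [IsFiniteMeasure μ] {G : X → Angle → ℂ → ℂ}
    (hG : ∀ x θ, Differentiable ℂ (G x θ)) (hGc : ∀ x, Continuous (Function.uncurry (G x)))
    {Gl : X → C(Param γ, ℂ)} (hGl : AnalyticOnNhd ℂ Gl univ)
    (hGeq : ∀ x k, Gl x k = G x k.1 (Param.circlePoint γ k)) :
    ∃ χ : ℂ × X → ℂ, AnalyticOnNhd ℂ χ (Metric.ball 0 (γ ^ 2) ×ˢ univ) ∧
      ∀ z : ℂ, 0 < z.im → ‖z‖ < γ ^ 2 → ∀ x : X,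
        ∫ θ, (∫ t in (0 : ℝ)..γ, (t : ℂ) ^ 0 * G x θ ((t : ℂ) ^ 2) /
          ((t : ℂ) ^ 2 - z * exp (2 * I * (θ.1 : ℂ)))) ∂μ =
        ∫ θ : Angle, I * Real.pi / (2 * (Complex.sqrt z * exp (I * (θ.1 : ℂ)))) *
          G x θ (z * exp (2 * I * (θ.1 : ℂ))) ∂μ + χ (z, x) := by
  refine exists_analytic_remainder hγ 0 μ hG hGc hGl hGeq
    (s := fun z θ => I * Real.pi / (2 * (Complex.sqrt z * exp (I * (θ.1 : ℂ)))))
    (R := fun z => ContinuousMap.const _ (-((γ : ℂ) ^ 2)) * regularDenominator γ z)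
    (r := fun z θ t => -((γ : ℂ) ^ 2 / ((γ : ℂ) ^ 4 - (t : ℂ) ^ 2 * (z * exp (2 * I * (θ.1 : ℂ))))))
    ?_ ?_ ?_ ?_ ?_
  · intro z
    simp only [div_eq_mul_inv, mul_inv, ← exp_neg]
    fun_prop
  · exact fun z hz => analyticAt_const.mul (analyticOnNhd_regularDenominator γ z hz)
  · intro z hz θ
    refine (ContinuousOn.div (by fun_prop) (by fun_prop) fun t ht h => ?_).neg
    have := pow_sub_mul_rotation_re_pos hz θ.1 ht
    simp [h] at this
  · intro z hz k
    rw [ContinuousMap.mul_apply, ContinuousMap.const_apply, regularDenominator_apply hz]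
    ring
  · intro z hz hzn θ
    have hz0 : z ≠ 0 := fun h => by simp [h] at hz
    have hsq : (Complex.sqrt z * exp (I * (θ.1 : ℂ))) ^ 2 = z * exp (2 * I * (θ.1 : ℂ)) := by
      rw [mul_pow, sqrt_sq, ← exp_nat_mul]
      push_cast
      ring_nf
    -- The argument of √z e^{iθ} is (arg z)/2 + θ, which lies in (0, π).
    have him : 0 < (Complex.sqrt z * exp (I * (θ.1 : ℂ))).im := by
      have h := im_log_add_rotation hz θ
      rw [sqrt_eq_exp hz0, ← exp_add,
        show log z / 2 + I * (θ.1 : ℂ) = (log z + 2 * I * (θ.1 : ℂ)) / 2 by ring, exp_im]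
      refine mul_pos (Real.exp_pos _) (Real.sin_pos_of_pos_of_lt_pi ?_ ?_)
      · rw [div_ofNat_im]
        linarith [h.1]
      · rw [div_ofNat_im]
        linarith [h.2]
    have h := integral_one_div_sq_sub hγ him (by rwa [hsq, norm_mul_rotation])
    rw [hsq] at h
    simp only [pow_zero]
    rw [h, intervalIntegral.integral_neg, sub_eq_add_neg]

theorem exists_analytic_remainder_even {X : Type*} [NormedAddCommGroup X] [NormedSpace ℂ X] {γ : ℝ}
    (hγ : 0 < γ) (μ : Measure Angle) [IsFiniteMeasure μ] {G : X → Angle → ℂ → ℂ}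
    (hG : ∀ x θ, Differentiable ℂ (G x θ)) (hGc : ∀ x, Continuous (Function.uncurry (G x)))
    {Gl : X → C(Param γ, ℂ)} (hGl : AnalyticOnNhd ℂ Gl univ)
    (hGeq : ∀ x k, Gl x k = G x k.1 (Param.circlePoint γ k)) :
    ∃ χ : ℂ × X → ℂ, AnalyticOnNhd ℂ χ (Metric.ball 0 (γ ^ 2) ×ˢ univ) ∧
      ∀ z : ℂ, 0 < z.im → ‖z‖ < γ ^ 2 → ∀ x : X,
        ∫ θ, (∫ t in (0 : ℝ)..γ, (t : ℂ) ^ 1 * G x θ ((t : ℂ) ^ 2) /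
          ((t : ℂ) ^ 2 - z * exp (2 * I * (θ.1 : ℂ)))) ∂μ =
        ∫ θ : Angle, -(1 / 2) * log z * G x θ (z * exp (2 * I * (θ.1 : ℂ))) ∂μ + χ (z, x) := by
  -- Division by γ makes the integral of this constant over [0, γ] equal to log γ + πi/2 - iθ. The
  -- term -iθ is the part of -(log z + 2iθ)/2 that is independent of z, so only log z stays
  -- singular.
  let c : C(Param γ, ℂ) := ⟨fun k => (Real.log γ + Real.pi * I / 2 - I * (k.1.1 : ℂ)) / γ, by
    fun_prop⟩
  refine exists_analytic_remainder hγ 1 μ hG hGc hGl hGeq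
    (s := fun z θ => -(1 / 2) * log z)
    (R := fun z => c - z • (Param.radius γ * Param.rotation γ) * regularDenominator γ z)
    (r := fun z θ t => (Real.log γ + Real.pi * I / 2 - I * (θ.1 : ℂ)) / γ -
      (t : ℂ) * (z * exp (2 * I * (θ.1 : ℂ))) /
        ((γ : ℂ) ^ 4 - (t : ℂ) ^ 2 * (z * exp (2 * I * (θ.1 : ℂ)))))
    ?_ ?_ ?_ ?_ ?_
  · intro z
    fun_prop
  · exact fun z hz => analyticAt_const.sub ((analyticAt_id.smul analyticAt_const).mul
      (analyticOnNhd_regularDenominator γ z hz))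
  · intro z hz θ
    refine continuousOn_const.sub (ContinuousOn.div (by fun_prop) (by fun_prop) fun t ht h => ?_)
    have := pow_sub_mul_rotation_re_pos hz θ.1 ht
    simp [h] at this
  · intro z hz k
    rw [ContinuousMap.sub_apply, ContinuousMap.mul_apply, ContinuousMap.smul_apply,
      ContinuousMap.mul_apply, regularDenominator_apply hz, smul_eq_mul, Param.radius_apply,
      Param.rotation_apply]
    simp only [c, ContinuousMap.coe_mk]
    ring
  · intro z hz hzn θ
    have hγ' : (γ : ℂ) ≠ 0 := by exact_mod_cast hγ.ne'
    have h := integral_id_div_sq_sub hγ (im_log_add_rotation hz θ).1 (im_log_add_rotation hz θ).2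
      (by rwa [exp_log_add_rotation hz, norm_mul_rotation])
    rw [exp_log_add_rotation hz] at h
    simp only [pow_one]
    rw [h, intervalIntegral.integral_sub intervalIntegrable_const]
    · rw [intervalIntegral.integral_const, sub_zero, real_smul, mul_div_cancel₀ _ hγ']
      generalize (∫ t in (0 : ℝ)..γ, _ : ℂ) = J
      ring
    · refine ContinuousOn.intervalIntegrable (ContinuousOn.div (by fun_prop) (by fun_prop)
        fun t ht h => ?_)
      rw [uIcc_of_le hγ.le] at ht
      have := pow_sub_mul_rotation_re_pos hzn θ.1 ht
      simp [h] at this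

/-! ### Reduction to an integral over a triangle. -/

theorem pairing_eq_linearForm {p q : ℕ} (x : Pos p q) (ξ : Freq p q) :
    pairing x ξ = linearForm x.1 ξ.1 + linearForm x.2 ξ.2 := rfl

theorem symbol_eq_norm {p q : ℕ} (ξ : Freq p q) : symbol ξ = ‖ξ.1‖ ^ 2 - ‖ξ.2‖ ^ 2 := by
  simp [symbol, EuclideanSpace.norm_sq_eq]

/-- The truncated resolvent in terms of the norms of the two frequency components. -/
def truncatedResolvent (γ : ℝ) (z : ℂ) (r s : ℝ) : ℂ :=
  if r + s < γ then 1 / ((r : ℂ) ^ 2 - (s : ℂ) ^ 2 - z) else 0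

theorem indicator_integrand {p q : ℕ} (γ : ℝ) (z : ℂ) (x : Pos p q) (ξ : Freq p q) :
    (region p q γ).indicator (integrand z x) ξ = exp (I * linearForm x.1 ξ.1) *
      (exp (I * linearForm x.2 ξ.2) * truncatedResolvent γ z ‖ξ.1‖ ‖ξ.2‖) := by
  by_cases h : ‖ξ.1‖ + ‖ξ.2‖ < γ
  · rw [indicator_of_mem (show ξ ∈ region p q γ from h), truncatedResolvent, if_pos h, integrand,
      pairing_eq_linearForm, symbol_eq_norm, mul_add, exp_add]
    push_cast
    ring
  · rw [indicator_of_notMem (show ξ ∉ region p q γ from h), truncatedResolvent, if_neg h]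
    ring

theorem measurableSet_region (p q : ℕ) (γ : ℝ) : MeasurableSet (region p q γ) :=
  (isOpen_lt (by fun_prop) continuous_const).measurableSet

theorem integral_integrand_eq {p q : ℕ} (hp : 1 ≤ p) (hq : 1 ≤ q) (γ : ℝ) {z : ℂ} (hz : 0 < z.im)
    (x : Pos p q) :
    ∫ ξ in region p q γ, integrand z x ξ =
      4 * (Real.pi : ℂ) ^ ((p : ℂ) / 2) * (Real.pi : ℂ) ^ ((q : ℂ) / 2) *
        ∫ r in Ioi (0 : ℝ), ∫ s in Ioi (0 : ℝ),
          ((r : ℂ) ^ (p - 1) * besselSum p ((∑ j, x.1 j ^ 2) * (r : ℂ) ^ 2)) *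
          ((s : ℂ) ^ (q - 1) * besselSum q ((∑ j, x.2 j ^ 2) * (s : ℂ) ^ 2)) *
            truncatedResolvent γ z r s := by
  have hint := (integrableOn_integrand γ hz x).integrable_indicator (measurableSet_region p q γ)
  rw [funext (indicator_integrand γ z x), Measure.volume_eq_prod] at hint
  rw [← integral_indicator (measurableSet_region p q γ), funext (indicator_integrand γ z x),
    Measure.volume_eq_prod, integral_prod _ hint]
  set g : ℝ → ℂ := fun r => 2 * (Real.pi : ℂ) ^ ((q : ℂ) / 2) * ∫ s in Ioi (0 : ℝ),
    (s : ℂ) ^ (q - 1) * (∑' k, seriesTerm q ((∑ j, x.2 j ^ 2) * (s : ℂ) ^ 2) k) *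
      truncatedResolvent γ z r s with hg
  have hinner : ∀ᵐ ξ : EuclideanSpace ℝ (Fin p), ∫ η : EuclideanSpace ℝ (Fin q),
      exp (I * linearForm x.1 ξ) * (exp (I * linearForm x.2 η) *
        truncatedResolvent γ z ‖ξ‖ ‖η‖) = exp (I * linearForm x.1 ξ) * g ‖ξ‖ := by
    filter_upwards [hint.prod_right_ae] with ξ hξ
    rw [integral_const_mul, integral_exp_mul_radial hq]
    -- Dividing by the nonvanishing plane wave in ξ' yields integrability of the inner factor alone.
    have := hξ.const_mul (exp (I * linearForm x.1 ξ))⁻¹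
    simpa [← mul_assoc, exp_ne_zero] using this
  rw [integral_congr_ae hinner, integral_exp_mul_radial hp x.1 g
    (hint.integral_prod_left.congr hinner), ← integral_const_mul, ← integral_const_mul]
  refine integral_congr_ae (.of_forall fun r => ?_)
  simp only [hg]
  rw [← integral_const_mul, ← integral_const_mul, ← integral_const_mul, ← integral_const_mul]
  refine integral_congr_ae (.of_forall fun s => ?_)
  simp only [besselSum]
  ring

/-- Fubini after s = t - r, then r = tu; the factor `t` is the Jacobian of the second substitution.
-/
theorem integral_triangle {f : ℝ → ℝ → ℂ} (hf : Continuous (Function.uncurry f)) {γ : ℝ}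
    (hγ : 0 < γ) :
    ∫ r in Ioi (0 : ℝ), ∫ s in Ioi (0 : ℝ), (if r + s < γ then f r s else 0) =
      ∫ t in (0 : ℝ)..γ, (t : ℂ) * ∫ u in (0 : ℝ)..1, f (t * u) (t * (1 - u)) := by
  let T : Set (ℝ × ℝ) := {y | 0 < y.1 ∧ y.1 < y.2 ∧ y.2 < γ}
  have hT : MeasurableSet T :=
    ((isOpen_lt continuous_const continuous_fst).inter
      ((isOpen_lt continuous_fst continuous_snd).inter
        (isOpen_lt continuous_snd continuous_const))).measurableSet
  let H : ℝ × ℝ → ℂ := T.indicator fun y => f y.1 (y.2 - y.1)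
  have hH : Integrable H (volume.prod volume) := by
    refine IntegrableOn.integrable_indicator ?_ hT
    have hc : Continuous fun y : ℝ × ℝ => f y.1 (y.2 - y.1) :=
      hf.comp (f := fun y : ℝ × ℝ => (y.1, y.2 - y.1)) (by fun_prop)
    refine (hc.continuousOn.integrableOn_compact
      (isCompact_Icc (a := ((0, 0) : ℝ × ℝ)) (b := (γ, γ)))).mono_set ?_
    rintro ⟨r, t⟩ ⟨h1, h2, h3⟩
    simp only at h1 h2 h3
    exact ⟨⟨h1.le, (h1.trans h2).le⟩, ⟨(h2.trans h3).le, h3.le⟩⟩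
  have h1 : ∀ r : ℝ, (Ioi (0 : ℝ)).indicator
      (fun r => ∫ s in Ioi (0 : ℝ), (if r + s < γ then f r s else 0)) r = ∫ t, H (r, t) := by
    intro r
    by_cases hr : 0 < r
    · rw [indicator_of_mem (show r ∈ Ioi 0 from hr), ← integral_indicator measurableSet_Ioi,
        ← integral_sub_right_eq_self _ r]
      refine integral_congr_ae (.of_forall fun t => ?_)
      simp only [H, T, indicator_apply, mem_Ioi, sub_pos, mem_ofPred_eq, add_sub_cancel, hr,
        true_and]
      split_ifs <;> tauto
    · rw [indicator_of_notMem (show r ∉ Ioi 0 from hr)]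
      simp [H, T, hr]
  have h2 : ∀ t : ℝ, ∫ r, H (r, t) = (Ioo 0 γ).indicator
      (fun t : ℝ => (t : ℂ) * ∫ u in (0 : ℝ)..1, f (t * u) (t * (1 - u))) t := by
    intro t
    by_cases ht : t ∈ Ioo 0 γ
    · have h3 : ∀ r, H (r, t) = (Ioo 0 t).indicator (fun r => f r (t - r)) r := fun r => by
        simp [H, T, indicator_apply, ht.2]
      have h4 := intervalIntegral.integral_comp_mul_left (a := 0) (b := 1)
        (fun r => f r (t - r)) ht.1.ne'
      rw [indicator_of_mem ht, funext h3, integral_indicator measurableSet_Ioo,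
        ← integral_Ioc_eq_integral_Ioo, ← intervalIntegral.integral_of_le ht.1.le]
      simp only [mul_zero, mul_one, real_smul] at h4
      have h5 : (t : ℂ) ≠ 0 := by exact_mod_cast ht.1.ne'
      simp only [mul_sub, mul_one]
      rw [h4, ofReal_inv, mul_inv_cancel_left₀ h5]
    · rw [indicator_of_notMem ht]
      have h3 : ∀ r, H (r, t) = 0 := fun r => by
        refine indicator_of_notMem (fun h => ht ⟨h.1.trans h.2.1, h.2.2⟩) _
      simp [h3]
  rw [← integral_indicator measurableSet_Ioi, funext h1,
    integral_integral_swap (f := fun r t => H (r, t)) hH, funext h2,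
    integral_indicator measurableSet_Ioo, ← integral_Ioc_eq_integral_Ioo,
    ← intervalIntegral.integral_of_le hγ.le]

/-! ### Contour deformation. -/

/-- The segment `[0, 1]` may be deformed to the lower half of the circle with diameter `[0, 1]`
if the integrand is holomorphic off a point of the upper half plane. -/
theorem integral_segment_eq_integral_semicircle {h : ℂ → ℂ} {w : ℂ} (hw : 0 < w.im)
    (hh : DifferentiableOn ℂ h {w}ᶜ) :
    ∫ u in (0 : ℝ)..1, h u = I * ∫ θ in (0 : ℝ)..Real.pi / 2,
      h ((1 + exp (-(2 * I * θ))) / 2) * exp (-(2 * I * θ)) := by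
  -- A disc centred far below the axis contains both paths but not `w`, and holomorphic functions on
  -- it have primitives. With M Im w = 1, the squared distance from the centre to `w` is at least M²
  -- + 2, while on both paths it is below M² + 1.
  set M : ℝ := 1 / w.im with hM
  have hM0 : 0 < M := by positivity
  set c : ℂ := 1 / 2 - M * I with hc
  have hnorm : ∀ u : ℂ, ‖u - c‖ ^ 2 = (u.re - 1 / 2) ^ 2 + (u.im + M) ^ 2 := fun u => by
    rw [← normSq_eq_norm_sq, normSq_apply, hc]
    simp
    ring
  have hball : ∀ u : ℂ, u ∈ Metric.ball c (Real.sqrt (M ^ 2 + 1)) ↔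
      (u.re - 1 / 2) ^ 2 + (u.im + M) ^ 2 < M ^ 2 + 1 := fun u => by
    rw [mem_ball_iff_norm, Real.lt_sqrt (norm_nonneg _), hnorm]
  have hsub : Metric.ball c (Real.sqrt (M ^ 2 + 1)) ⊆ {w}ᶜ := by
    rintro u hu rfl
    rw [hball] at hu
    have : u.im * M = 1 := by rw [hM]; field_simp
    nlinarith [sq_nonneg (u.re - 1 / 2), sq_nonneg u.im]
  obtain ⟨P, hP⟩ := (hh.mono hsub).isExactOn_ball
  have hcont : ContinuousOn h (Metric.ball c (Real.sqrt (M ^ 2 + 1))) :=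
    (hh.mono hsub).continuousOn
  have hm1 : ∀ u ∈ uIcc (0 : ℝ) 1, (u : ℂ) ∈ Metric.ball c (Real.sqrt (M ^ 2 + 1)) := by
    intro u hu
    rw [uIcc_of_le zero_le_one] at hu
    rw [hball]
    simp only [ofReal_re, ofReal_im]
    nlinarith [hu.1, hu.2]
  have hm2 : ∀ θ ∈ uIcc (0 : ℝ) (Real.pi / 2),
      (1 + exp (-(2 * I * θ))) / 2 ∈ Metric.ball c (Real.sqrt (M ^ 2 + 1)) := by
    intro θ hθ
    rw [uIcc_of_le (by positivity)] at hθ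
    have he : exp (-(2 * I * θ)) = Real.cos (2 * θ) - Real.sin (2 * θ) * I := by
      rw [show -(2 * I * (θ : ℂ)) = (-(2 * θ) : ℝ) * I by push_cast; ring, exp_mul_I]
      push_cast
      rw [Complex.cos_neg, Complex.sin_neg]
      ring
    have hs : 0 ≤ Real.sin (2 * θ) :=
      Real.sin_nonneg_of_nonneg_of_le_pi (by linarith [hθ.1]) (by linarith [hθ.2])
    have hre : ((1 + exp (-(2 * I * θ))) / 2).re = (1 + Real.cos (2 * θ)) / 2 := by
      rw [he, div_ofNat_re]
      simp [-ofReal_cos, -ofReal_sin]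
    have him : ((1 + exp (-(2 * I * θ))) / 2).im = -Real.sin (2 * θ) / 2 := by
      rw [he, div_ofNat_im]
      simp [-ofReal_cos, -ofReal_sin]
    rw [hball, hre, him]
    nlinarith [Real.sin_sq_add_cos_sq (2 * θ), mul_nonneg hs hM0.le]
  have e1 := intervalIntegral.integral_eq_sub_of_hasDerivAt (a := 0) (b := 1)
    (f := fun u : ℝ => P u) (f' := fun u : ℝ => h u)
    (fun u hu => (hP u (hm1 u hu)).comp_ofReal)
    (hcont.comp (by fun_prop) hm1).intervalIntegrable
  have hd : ∀ θ : ℝ, HasDerivAt (fun θ : ℝ => (1 + exp (-(2 * I * θ))) / 2)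
      (-I * exp (-(2 * I * θ))) θ := fun θ => by
    have h0 : HasDerivAt (fun t : ℝ => (t : ℂ)) 1 θ := (hasDerivAt_id θ).ofReal_comp
    refine ((((h0.const_mul (2 * I)).neg.cexp).const_add 1).div_const 2).congr_deriv ?_
    simp only [Pi.neg_apply]
    ring
  have e2 := intervalIntegral.integral_eq_sub_of_hasDerivAt (a := 0) (b := Real.pi / 2)
    (f := fun θ : ℝ => P ((1 + exp (-(2 * I * θ))) / 2))
    (f' := fun θ : ℝ => h ((1 + exp (-(2 * I * θ))) / 2) * (-I * exp (-(2 * I * θ))))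
    (fun θ hθ => (hP _ (hm2 θ hθ)).comp_of_eq θ (hd θ) rfl)
    (((hcont.comp (by fun_prop) hm2).mul (by fun_prop)).intervalIntegrable)
  have hend : (1 + exp (-(2 * I * (Real.pi / 2 : ℝ)))) / 2 = 0 := by
    rw [show -(2 * I * ((Real.pi / 2 : ℝ) : ℂ)) = -(Real.pi * I) by push_cast; ring, exp_neg,
      exp_pi_mul_I]
    norm_num
  have hstart : (1 + exp (-(2 * I * (0 : ℝ)))) / 2 = 1 := by
    simp
  rw [hend, hstart] at e2
  rw [e1, ← intervalIntegral.integral_const_mul]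
  have e3 : ∫ θ in (0 : ℝ)..Real.pi / 2, I * (h ((1 + exp (-(2 * I * θ))) / 2) *
      exp (-(2 * I * θ))) = -∫ θ in (0 : ℝ)..Real.pi / 2, h ((1 + exp (-(2 * I * θ))) / 2) *
      (-I * exp (-(2 * I * θ))) := by
    rw [← intervalIntegral.integral_neg]
    exact intervalIntegral.integral_congr fun θ _ => by ring
  rw [e3, e2]
  simp

/-! ### Beta integrals and the addition theorem. -/

/-- The integral `∫ cos ^ m sin ^ n` over the first quadrant. -/
def cosSinIntegral (m n : ℕ) : ℝ := ∫ θ in (0 : ℝ)..Real.pi / 2, Real.cos θ ^ m * Real.sin θ ^ n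

theorem intervalIntegrable_cos_pow_mul_sin_pow (m n : ℕ) :
    IntervalIntegrable (fun θ => Real.cos θ ^ m * Real.sin θ ^ n) volume 0 (Real.pi / 2) :=
  (by fun_prop : Continuous fun θ => Real.cos θ ^ m * Real.sin θ ^ n).intervalIntegrable _ _

theorem cosSinIntegral_add (m n : ℕ) :
    cosSinIntegral (m + 2) n + cosSinIntegral m (n + 2) = cosSinIntegral m n := by
  rw [cosSinIntegral, cosSinIntegral, cosSinIntegral, ← intervalIntegral.integral_add
    (intervalIntegrable_cos_pow_mul_sin_pow _ _) (intervalIntegrable_cos_pow_mul_sin_pow _ _)]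
  refine intervalIntegral.integral_congr fun θ _ => ?_
  linear_combination (Real.cos θ ^ m * Real.sin θ ^ n) * Real.sin_sq_add_cos_sq θ

/-- The difference of the two sides is the integral of the derivative of cos^{m+1} sin^{n+1}, which
vanishes at both ends. -/
theorem cosSinIntegral_parts (m n : ℕ) :
    ((n : ℝ) + 1) * cosSinIntegral (m + 2) n = ((m : ℝ) + 1) * cosSinIntegral m (n + 2) := by
  have h := intervalIntegral.integral_eq_sub_of_hasDerivAt (a := 0) (b := Real.pi / 2)
    (f := fun θ => Real.cos θ ^ (m + 1) * Real.sin θ ^ (n + 1))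
    (f' := fun θ => ((n : ℝ) + 1) * (Real.cos θ ^ (m + 2) * Real.sin θ ^ n) -
      ((m : ℝ) + 1) * (Real.cos θ ^ m * Real.sin θ ^ (n + 2)))
    (fun θ _ => by
      refine (((Real.hasDerivAt_cos θ).pow (m + 1)).mul
        ((Real.hasDerivAt_sin θ).pow (n + 1))).congr_deriv ?_
      simp only [Pi.pow_apply, Nat.add_sub_cancel]
      push_cast
      ring)
    (((intervalIntegrable_cos_pow_mul_sin_pow _ _).const_mul _).sub
      ((intervalIntegrable_cos_pow_mul_sin_pow _ _).const_mul _))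
  rw [intervalIntegral.integral_sub ((intervalIntegrable_cos_pow_mul_sin_pow _ _).const_mul _)
    ((intervalIntegrable_cos_pow_mul_sin_pow _ _).const_mul _),
    intervalIntegral.integral_const_mul, intervalIntegral.integral_const_mul] at h
  simp only [Real.cos_pi_div_two, Real.sin_zero, zero_pow (Nat.succ_ne_zero _), zero_mul, mul_zero,
    sub_zero] at h
  exact sub_eq_zero.1 h

/-- Raising either exponent by 2 changes both sides by the same factor, which leaves the four cases
with exponents 0 and 1. -/
theorem cosSinIntegral_mul_Gamma (m n : ℕ) :
    2 * cosSinIntegral m n * Real.Gamma (((m : ℝ) + n) / 2 + 1) =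
      Real.Gamma (((m : ℝ) + 1) / 2) * Real.Gamma (((n : ℝ) + 1) / 2) := by
  have hm : ∀ m n : ℕ, ((m : ℝ) + n + 2) * cosSinIntegral (m + 2) n =
      ((m : ℝ) + 1) * cosSinIntegral m n := fun m n => by
    linear_combination cosSinIntegral_parts m n + ((m : ℝ) + 1) * cosSinIntegral_add m n
  have hn : ∀ m n : ℕ, ((m : ℝ) + n + 2) * cosSinIntegral m (n + 2) =
      ((n : ℝ) + 1) * cosSinIntegral m n := fun m n => by
    linear_combination -cosSinIntegral_parts m n + ((n : ℝ) + 1) * cosSinIntegral_add m n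
  have hG : ∀ x : ℝ, 0 < x → Real.Gamma (x + 1) = x * Real.Gamma x := fun x hx =>
    Real.Gamma_add_one hx.ne'
  have hhalf : Real.Gamma (1 / 2 + 1) = 1 / 2 * Real.sqrt Real.pi := by
    rw [hG _ (by norm_num), Real.Gamma_one_half_eq]
  induction m using Nat.twoStepInduction with
  | zero =>
    induction n using Nat.twoStepInduction with
    | zero =>
      simp [cosSinIntegral, Real.Gamma_one_half_eq, -one_div]
      rw [← pow_two, Real.sq_sqrt Real.pi_pos.le]
      ring
    | one =>
      have : cosSinIntegral 0 1 = 1 := by simp [cosSinIntegral]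
      rw [this, show (((0 : ℕ) : ℝ) + (1 : ℕ)) / 2 + 1 = 1 / 2 + 1 by norm_num,
        show (((0 : ℕ) : ℝ) + 1) / 2 = 1 / 2 by norm_num,
        show (((1 : ℕ) : ℝ) + 1) / 2 = 1 by norm_num, hhalf, Real.Gamma_one_half_eq,
        Real.Gamma_one]
      ring
    | more n ih _ =>
      have h1 := hG ((((0 : ℕ) : ℝ) + n) / 2 + 1) (by positivity)
      have h2 := hG (((n : ℝ) + 1) / 2) (by positivity)
      have h3 := hn 0 n
      rw [show (((n + 2 : ℕ) : ℝ) + 1) / 2 = ((n : ℝ) + 1) / 2 + 1 by push_cast; ring,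
        show (((0 : ℕ) : ℝ) + (n + 2 : ℕ)) / 2 + 1 = (((0 : ℕ) : ℝ) + n) / 2 + 1 + 1 by
          push_cast; ring, h1, h2]
      linear_combination ((n : ℝ) + 1) / 2 * ih +
        Real.Gamma ((((0 : ℕ) : ℝ) + n) / 2 + 1) * h3
  | one =>
    induction n using Nat.twoStepInduction with
    | zero =>
      have : cosSinIntegral 1 0 = 1 := by simp [cosSinIntegral]
      rw [this, show (((1 : ℕ) : ℝ) + (0 : ℕ)) / 2 + 1 = 1 / 2 + 1 by norm_num,
        show (((0 : ℕ) : ℝ) + 1) / 2 = 1 / 2 by norm_num,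
        show (((1 : ℕ) : ℝ) + 1) / 2 = 1 by norm_num, hhalf, Real.Gamma_one_half_eq,
        Real.Gamma_one]
      ring
    | one =>
      have : cosSinIntegral 1 1 = 1 / 2 := by
        simp only [cosSinIntegral, pow_one]
        rw [intervalIntegral.integral_congr fun θ _ => mul_comm _ _, integral_sin_mul_cos₁]
        simp
      rw [this]
      norm_num
    | more n ih _ =>
      have h1 := hG ((((1 : ℕ) : ℝ) + n) / 2 + 1) (by positivity)
      have h2 := hG (((n : ℝ) + 1) / 2) (by positivity)
      have h3 := hn 1 n
      rw [show (((n + 2 : ℕ) : ℝ) + 1) / 2 = ((n : ℝ) + 1) / 2 + 1 by push_cast; ring,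
        show (((1 : ℕ) : ℝ) + (n + 2 : ℕ)) / 2 + 1 = (((1 : ℕ) : ℝ) + n) / 2 + 1 + 1 by
          push_cast; ring, h1, h2]
      linear_combination ((n : ℝ) + 1) / 2 * ih +
        Real.Gamma ((((1 : ℕ) : ℝ) + n) / 2 + 1) * h3
  | more m ih _ =>
    have h1 := hG (((m : ℝ) + n) / 2 + 1) (by positivity)
    have h2 := hG (((m : ℝ) + 1) / 2) (by positivity)
    have h3 := hm m n
    rw [show (((m + 2 : ℕ) : ℝ) + 1) / 2 = ((m : ℝ) + 1) / 2 + 1 by push_cast; ring,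
      show (((m + 2 : ℕ) : ℝ) + n) / 2 + 1 = ((m : ℝ) + n) / 2 + 1 + 1 by push_cast; ring, h1, h2]
    linear_combination ((m : ℝ) + 1) / 2 * ih + Real.Gamma (((m : ℝ) + n) / 2 + 1) * h3

/-- The Gamma factors in the numerator of the beta integral cancel those of the two series. The
surviving one depends on j + k only, which makes the addition theorem possible. -/
theorem integral_cos_sin_seriesTerm {p q : ℕ} (hp : 1 ≤ p) (hq : 1 ≤ q) (X Y : ℂ) (j k : ℕ) :
    ∫ θ in (0 : ℝ)..Real.pi / 2, (Real.cos θ : ℂ) ^ (p - 1) * (Real.sin θ : ℂ) ^ (q - 1) *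
        (seriesTerm p (X * (Real.cos θ : ℂ) ^ 2) j * seriesTerm q (Y * (Real.sin θ : ℂ) ^ 2) k) =
      (-X / 4) ^ j * (-Y / 4) ^ k / ((j.factorial : ℂ) * (k.factorial : ℂ) *
        Complex.Gamma (((j + k : ℕ) : ℂ) + ((p + q : ℕ) : ℂ) / 2)) / 2 := by
  have h := congrArg (fun x : ℝ => (x : ℂ))
    (cosSinIntegral_mul_Gamma (p - 1 + 2 * j) (q - 1 + 2 * k))
  have e1 : ((p - 1 + 2 * j : ℕ) : ℝ) = (p : ℝ) - 1 + 2 * j := by push_cast [hp]; ring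
  have e2 : ((q - 1 + 2 * k : ℕ) : ℝ) = (q : ℝ) - 1 + 2 * k := by push_cast [hq]; ring
  simp only [e1, e2, Complex.ofReal_mul, ← Complex.Gamma_ofReal] at h
  have hc : ∫ θ in (0 : ℝ)..Real.pi / 2,
      (Real.cos θ : ℂ) ^ (p - 1) * (Real.sin θ : ℂ) ^ (q - 1) *
        (seriesTerm p (X * (Real.cos θ : ℂ) ^ 2) j * seriesTerm q (Y * (Real.sin θ : ℂ) ^ 2) k) =
      seriesTerm p X j * seriesTerm q Y k *
        (cosSinIntegral (p - 1 + 2 * j) (q - 1 + 2 * k) : ℝ) := by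
    rw [cosSinIntegral, ← intervalIntegral.integral_ofReal, ← intervalIntegral.integral_const_mul]
    refine intervalIntegral.integral_congr fun θ _ => ?_
    simp only [seriesTerm, ← neg_mul, mul_div_right_comm, mul_pow, ← pow_mul]
    push_cast
    ring
  have g1 : Complex.Gamma ((j : ℂ) + (p : ℂ) / 2) ≠ 0 :=
    Complex.Gamma_ne_zero_of_re_pos (by
      simp only [Complex.add_re, Complex.div_ofNat_re, Complex.natCast_re]; positivity)
  have g2 : Complex.Gamma ((k : ℂ) + (q : ℂ) / 2) ≠ 0 :=
    Complex.Gamma_ne_zero_of_re_pos (by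
      simp only [Complex.add_re, Complex.div_ofNat_re, Complex.natCast_re]; positivity)
  have g3 : Complex.Gamma (((j + k : ℕ) : ℂ) + ((p + q : ℕ) : ℂ) / 2) ≠ 0 :=
    Complex.Gamma_ne_zero_of_re_pos (by
      simp only [Complex.add_re, Complex.div_ofNat_re, Complex.natCast_re]; positivity)
  have f1 : (j.factorial : ℂ) ≠ 0 := by exact_mod_cast j.factorial_ne_zero
  have f2 : (k.factorial : ℂ) ≠ 0 := by exact_mod_cast k.factorial_ne_zero
  have a1 : ((((p : ℝ) - 1 + 2 * j + ((q : ℝ) - 1 + 2 * k)) / 2 + 1 : ℝ) : ℂ) =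
      ((j + k : ℕ) : ℂ) + ((p + q : ℕ) : ℂ) / 2 := by push_cast; ring
  have a2 : ((((p : ℝ) - 1 + 2 * j + 1) / 2 : ℝ) : ℂ) = (j : ℂ) + (p : ℂ) / 2 := by
    push_cast; ring
  have a3 : ((((q : ℝ) - 1 + 2 * k + 1) / 2 : ℝ) : ℂ) = (k : ℂ) + (q : ℂ) / 2 := by
    push_cast; ring
  rw [a1, a2, a3] at h
  rw [hc, seriesTerm, seriesTerm]
  push_cast at h g3 ⊢
  generalize Complex.Gamma _ = u at h g3 ⊢
  generalize Complex.Gamma _ = v at h g1 ⊢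
  generalize Complex.Gamma _ = w at h g2 ⊢
  field_simp
  linear_combination (-X / 4) ^ j * (-Y / 4) ^ k * h

/-- The addition theorem relating `besselSum p`, `besselSum q` and `besselSum (p + q)`. -/
theorem integral_besselSum_mul_besselSum {p q : ℕ} (hp : 1 ≤ p) (hq : 1 ≤ q) (X Y : ℂ) :
    ∫ θ in (0 : ℝ)..Real.pi / 2, (Real.cos θ : ℂ) ^ (p - 1) * (Real.sin θ : ℂ) ^ (q - 1) *
        (besselSum p (X * (Real.cos θ : ℂ) ^ 2) * besselSum q (Y * (Real.sin θ : ℂ) ^ 2)) =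
      besselSum (p + q) (X + Y) / 2 := by
  have hpow : ∀ (d : ℕ) (W : ℂ) (c : ℝ) (j : ℕ), |c| ≤ 1 →
      ‖seriesTerm d (W * (c : ℂ) ^ 2) j‖ ≤ ‖seriesTerm d W j‖ := fun d W c j hc => by
    rw [seriesTerm_eq_mul_pow, seriesTerm_eq_mul_pow d W, mul_pow, ← mul_assoc, norm_mul]
    refine mul_le_of_le_one_right (norm_nonneg _) ?_
    rw [norm_pow, norm_pow, Complex.norm_real, Real.norm_eq_abs, ← pow_mul]
    exact pow_le_one₀ (abs_nonneg _) hc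
  have hcont : ∀ (d j : ℕ), Continuous fun w => seriesTerm d w j := fun d j => by
    unfold seriesTerm
    fun_prop
  have hsum := (summable_seriesTerm p X).norm.mul_of_nonneg (summable_seriesTerm q Y).norm
    (fun _ => norm_nonneg _) (fun _ => norm_nonneg _)
  have hhas := intervalIntegral.hasSum_integral_of_dominated_convergence (μ := volume)
    (a := 0) (b := Real.pi / 2)
    (F := fun (y : ℕ × ℕ) (θ : ℝ) =>
      (Real.cos θ : ℂ) ^ (p - 1) * (Real.sin θ : ℂ) ^ (q - 1) *
        (seriesTerm p (X * (Real.cos θ : ℂ) ^ 2) y.1 *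
          seriesTerm q (Y * (Real.sin θ : ℂ) ^ 2) y.2))
    (f := fun θ : ℝ => (Real.cos θ : ℂ) ^ (p - 1) * (Real.sin θ : ℂ) ^ (q - 1) *
        (besselSum p (X * (Real.cos θ : ℂ) ^ 2) * besselSum q (Y * (Real.sin θ : ℂ) ^ 2)))
    (fun y _ => ‖seriesTerm p X y.1‖ * ‖seriesTerm q Y y.2‖)
    (fun y => by
      apply Continuous.aestronglyMeasurable
      have h1 := hcont p y.1
      have h2 := hcont q y.2
      fun_prop)
    (fun y => .of_forall fun θ _ => by
      have hc : ‖(Real.cos θ : ℂ)‖ ≤ 1 := by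
        rw [Complex.norm_real]
        exact Real.abs_cos_le_one θ
      have hs : ‖(Real.sin θ : ℂ)‖ ≤ 1 := by
        rw [Complex.norm_real]
        exact Real.abs_sin_le_one θ
      rw [norm_mul, norm_mul, norm_mul, norm_pow, norm_pow]
      refine (mul_le_of_le_one_left (by positivity) (mul_le_one₀ (pow_le_one₀ (norm_nonneg _) hc)
        (by positivity) (pow_le_one₀ (norm_nonneg _) hs))).trans ?_
      gcongr
      · exact hpow p X _ _ (Real.abs_cos_le_one θ)
      · exact hpow q Y _ _ (Real.abs_sin_le_one θ))
    (.of_forall fun θ _ => hsum)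
    intervalIntegrable_const
    (.of_forall fun θ _ => by
      have s1 := summable_seriesTerm p (X * (Real.cos θ : ℂ) ^ 2)
      have s2 := summable_seriesTerm q (Y * (Real.sin θ : ℂ) ^ 2)
      exact (s1.hasSum.mul s2.hasSum (summable_mul_of_summable_norm s1.norm s2.norm)).mul_left _)
  simp only [integral_cos_sin_seriesTerm hp hq] at hhas
  -- Grouped by j + k = n, the double series becomes the binomial expansion of (X + Y)^n.
  have hanti :=
    ((Finset.HasAntidiagonal.sigmaAntidiagonalEquivProd (A := ℕ)).hasSum_iff.2 hhas).sigma
      (fun n => hasSum_fintype _)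
  refine hanti.unique ?_
  refine ((summable_seriesTerm (p + q) (X + Y)).hasSum.div_const 2).congr_fun fun n => ?_
  have hn : (n.factorial : ℂ) ≠ 0 := by exact_mod_cast n.factorial_ne_zero
  rw [seriesTerm, show -(X + Y) / 4 = -X / 4 + -Y / 4 by ring, (Commute.all _ _).add_pow',
    Finset.sum_div, Finset.sum_div]
  refine (Finset.sum_coe_sort (Finset.HasAntidiagonal.antidiagonal n) (fun y : ℕ × ℕ =>
    (-X / 4) ^ y.1 * (-Y / 4) ^ y.2 / ((y.1.factorial : ℂ) * (y.2.factorial : ℂ) *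
      Complex.Gamma (((y.1 + y.2 : ℕ) : ℂ) + ((p + q : ℕ) : ℂ) / 2)) / 2)).trans ?_
  refine Finset.sum_congr rfl fun y hy => ?_
  have hyn : y.1 + y.2 = n := Finset.HasAntidiagonal.mem_antidiagonal.1 hy
  have f1 : (y.1.factorial : ℂ) ≠ 0 := by exact_mod_cast y.1.factorial_ne_zero
  have f2 : (y.2.factorial : ℂ) ≠ 0 := by exact_mod_cast y.2.factorial_ne_zero
  have hch : (n.choose y.1 : ℂ) * y.1.factorial * y.2.factorial = n.factorial := by
    have := Nat.add_choose_mul_factorial_mul_factorial y.1 y.2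
    rw [← Nat.choose_symm_add, hyn] at this
    exact_mod_cast this
  rw [hyn, nsmul_eq_mul, ← hch, mul_comm (n.choose y.1 : ℂ) (_ * _)]
  have hc0 : (n.choose y.1 : ℂ) ≠ 0 := fun h => by
    rw [h, zero_mul, zero_mul] at hch
    exact hn hch.symm
  field_simp

/-! ### Angular representations and how they yield the expansion. -/

/-- A representation of the truncated resolvent integral as a superposition over angles `θ` of
one-dimensional resolvent integrals with spectral parameter `z e^{2 i θ}`. -/
structure AngularRepresentation (p q ε l : ℕ) (γ : ℝ) where
  /-- The measure on the angles. -/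
  μ : Measure Angle
  finite : IsFiniteMeasure μ
  /-- The normalization constant. -/
  C : ℂ
  /-- The densities. -/
  G : Pos p q → Angle → ℂ → ℂ
  /-- The densities on the circle of radius `γ ^ 2 + 1`. -/
  Gl : Pos p q → C(Param γ, ℂ)
  differentiable : ∀ x θ, Differentiable ℂ (G x θ)
  continuous : ∀ x, Continuous (Function.uncurry (G x))
  analytic : AnalyticOnNhd ℂ Gl univ
  lift_apply : ∀ x k, Gl x k = G x k.1 (Param.circlePoint γ k)
  integral_eq : ∀ z : ℂ, 0 < z.im → ∀ x : Pos p q,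
    ∫ ξ in region p q γ, integrand z x ξ =
      C * ∫ θ, (∫ t in (0 : ℝ)..γ, (t : ℂ) ^ ε * G x θ ((t : ℂ) ^ 2) /
        ((t : ℂ) ^ 2 - z * exp (2 * I * (θ.1 : ℂ)))) ∂μ
  -- The exponential is the θ-dependence of the singular coefficient: e^{-iθ} from 1/(√z e^{iθ}) if
  -- ε = 0, and none if ε = 1, since there only log z is singular.
  singular_eq : ∀ (z : ℂ) (x : Pos p q),
    C * ∫ θ : Angle, exp (-((1 - (ε : ℂ)) * (I * (θ.1 : ℂ)))) *
        G x θ (z * exp (2 * I * (θ.1 : ℂ))) ∂μ =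
      2 * (Real.pi : ℂ) ^ (((p + q : ℕ) : ℂ) / 2) * I ^ q * z ^ l *
        besselSum (p + q) (z * form x)

theorem E_eq_besselSum (p q : ℕ) (w : ℂ) :
    E p q w = I ^ q / ((2 : ℂ) ^ (p + q) * (Real.pi : ℂ) ^ (((p + q : ℕ) : ℂ) / 2)) *
      besselSum (p + q) w := rfl

theorem pi_cpow_mul_self (d : ℕ) :
    (Real.pi : ℂ) ^ ((d : ℂ) / 2) * (Real.pi : ℂ) ^ ((d : ℂ) / 2) = (Real.pi : ℂ) ^ d := by
  rw [← cpow_add _ _ (by exact_mod_cast Real.pi_ne_zero), add_halves, cpow_natCast]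

theorem pi_cpow_ne_zero (s : ℂ) : (Real.pi : ℂ) ^ s ≠ 0 := by
  rw [Ne, cpow_eq_zero_iff]
  exact fun h => Real.pi_ne_zero (by exact_mod_cast h.1)

/-- Matches the constants: (2π)^{-d} times π^{d/2} is the prefactor 1/(2^d π^{d/2}) of `E`. -/
theorem mul_E_eq (p q : ℕ) (c w : ℂ) :
    ((2 * Real.pi : ℂ) ^ (p + q))⁻¹ * (c *
      (2 * (Real.pi : ℂ) ^ (((p + q : ℕ) : ℂ) / 2) * I ^ q * besselSum (p + q) w)) =
      2 * c * E p q w := by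
  have h := pi_cpow_mul_self (p + q)
  have h1 := pi_cpow_ne_zero (((p + q : ℕ) : ℂ) / 2)
  rw [E_eq_besselSum, mul_pow, ← h]
  generalize (Real.pi : ℂ) ^ (((p + q : ℕ) : ℂ) / 2) = u at *
  field_simp

theorem sqrt_ne_zero {z : ℂ} (hz : z ≠ 0) : Complex.sqrt z ≠ 0 := fun h => hz (by
  rw [← sqrt_sq (z := z), h]
  ring)

theorem AngularRepresentation.odd {p q l : ℕ} {γ : ℝ} (hγ : 0 < γ) (hpq : p + q = 2 * l + 1)
    (A : AngularRepresentation p q 0 l γ) :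
    ∃ χ : ℂ × Pos p q → ℂ, AnalyticOnNhd ℂ χ (Metric.ball (0 : ℂ) (γ ^ 2) ×ˢ univ) ∧
      ∀ z : ℂ, 0 < z.im → ‖z‖ < γ ^ 2 → ∀ x : Pos p q,
        kernel γ z x = I * (Real.pi : ℂ) * Complex.sqrt z ^ (((p + q : ℕ) : ℤ) - 2) *
          E p q (z * form x) + χ (z, x) := by
  have := A.finite
  obtain ⟨χ, hχ, h⟩ := exists_analytic_remainder_odd hγ A.μ A.differentiable A.continuous
    A.analytic A.lift_apply
  refine ⟨fun y => ((2 * Real.pi : ℂ) ^ (p + q))⁻¹ * A.C * χ y,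
    fun y hy => analyticAt_const.mul (hχ y hy), fun z hz hzn x => ?_⟩
  have hz0 : z ≠ 0 := fun h0 => by simp [h0] at hz
  have hs := sqrt_ne_zero hz0
  have hsing : A.C * ∫ θ : Angle, I * Real.pi / (2 * (Complex.sqrt z * exp (I * (θ.1 : ℂ)))) *
      A.G x θ (z * exp (2 * I * (θ.1 : ℂ))) ∂A.μ = I * Real.pi / (2 * Complex.sqrt z) * z ^ l *
        (2 * (Real.pi : ℂ) ^ (((p + q : ℕ) : ℂ) / 2) * I ^ q * besselSum (p + q) (z * form x)) := by
    have h1 := congrArg (fun y => I * Real.pi / (2 * Complex.sqrt z) * y) (A.singular_eq z x)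
    simp only [Nat.cast_zero, sub_zero, one_mul] at h1
    rw [mul_left_comm, ← integral_const_mul] at h1
    rw [← integral_const_mul] at h1 ⊢
    refine Eq.trans (integral_congr_ae (.of_forall fun θ => ?_)) (h1.trans (by ring))
    simp only
    rw [exp_neg]
    field_simp
  -- The exponent d - 2 is -1 for d = 1, hence the integer power and the quotient.
  have hpow : Complex.sqrt z ^ (((p + q : ℕ) : ℤ) - 2) = z ^ l / Complex.sqrt z := by
    rw [hpq, show (((2 * l + 1 : ℕ) : ℤ) - 2) = ((2 * l : ℕ) : ℤ) - 1 by push_cast; ring,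
      zpow_sub_one₀ hs, zpow_natCast, pow_mul, sqrt_sq, div_eq_mul_inv]
  rw [kernel, A.integral_eq z hz, h z hz hzn, mul_add, hsing, mul_add, mul_E_eq, hpow]
  ring

theorem AngularRepresentation.even {p q l : ℕ} {γ : ℝ} (hγ : 0 < γ) (hpq : p + q = 2 * l + 2)
    (A : AngularRepresentation p q 1 l γ) :
    ∃ χ : ℂ × Pos p q → ℂ, AnalyticOnNhd ℂ χ (Metric.ball (0 : ℂ) (γ ^ 2) ×ˢ univ) ∧
      ∀ z : ℂ, 0 < z.im → ‖z‖ < γ ^ 2 → ∀ x : Pos p q,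
        kernel γ z x = -(Complex.sqrt z ^ (((p + q : ℕ) : ℤ) - 2) * log z *
          E p q (z * form x)) + χ (z, x) := by
  have := A.finite
  obtain ⟨χ, hχ, h⟩ := exists_analytic_remainder_even hγ A.μ A.differentiable A.continuous
    A.analytic A.lift_apply
  refine ⟨fun y => ((2 * Real.pi : ℂ) ^ (p + q))⁻¹ * A.C * χ y,
    fun y hy => analyticAt_const.mul (hχ y hy), fun z hz hzn x => ?_⟩
  have hsing : A.C * ∫ θ : Angle, -(1 / 2) * log z *
      A.G x θ (z * exp (2 * I * (θ.1 : ℂ))) ∂A.μ = -(1 / 2) * log z * z ^ l *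
        (2 * (Real.pi : ℂ) ^ (((p + q : ℕ) : ℂ) / 2) * I ^ q * besselSum (p + q) (z * form x)) := by
    have h1 := A.singular_eq z x
    simp only [Nat.cast_one, sub_self, zero_mul, neg_zero, exp_zero, one_mul] at h1
    rw [integral_const_mul, mul_left_comm, h1]
    ring
  have hpow : Complex.sqrt z ^ (((p + q : ℕ) : ℤ) - 2) = z ^ l := by
    rw [hpq, show (((2 * l + 2 : ℕ) : ℤ) - 2) = ((2 * l : ℕ) : ℤ) by push_cast; ring,
      zpow_natCast, pow_mul, sqrt_sq]
  rw [kernel, A.integral_eq z hz, h z hz hzn, mul_add, hsing, mul_add, mul_E_eq, hpow]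
  ring

theorem analyticOnNhd_besselComp_smul {γ : ℝ} {X : Type*} [NormedAddCommGroup X] [NormedSpace ℂ X]
    (d : ℕ) {a : X → ℂ} (ha : AnalyticOnNhd ℂ a univ) (f : C(Param γ, ℂ)) :
    AnalyticOnNhd ℂ (fun x => besselComp d (a x • f)) univ := fun x _ =>
  (analyticOnNhd_besselComp d _ trivial).comp_of_eq ((ha x trivial).smul analyticAt_const) rfl

theorem analyticOnNhd_sum_sq_fst (p q : ℕ) :
    AnalyticOnNhd ℂ (fun x : Pos p q => ∑ j, x.1 j ^ 2) univ := fun x _ => by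
  refine Finset.analyticAt_fun_sum _ fun j _ => AnalyticAt.pow ?_ 2
  exact ((ContinuousLinearMap.proj j).comp
    (ContinuousLinearMap.fst ℂ (Fin p → ℂ) (Fin q → ℂ))).analyticAt x

theorem analyticOnNhd_sum_sq_snd (p q : ℕ) :
    AnalyticOnNhd ℂ (fun x : Pos p q => ∑ j, x.2 j ^ 2) univ := fun x _ => by
  refine Finset.analyticAt_fun_sum _ fun j _ => AnalyticAt.pow ?_ 2
  exact ((ContinuousLinearMap.proj j).comp
    (ContinuousLinearMap.snd ℂ (Fin p → ℂ) (Fin q → ℂ))).analyticAt x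

/-! ### The rotated contour and the mixed signature. -/

/-- The radius of the first frequency component on the rotated contour. -/
def cosFactor (θ : ℝ) : ℂ := Real.cos θ * exp (-(I * θ))

/-- The radius of the second frequency component on the rotated contour. -/
def sinFactor (θ : ℝ) : ℂ := I * Real.sin θ * exp (-(I * θ))

@[fun_prop]
theorem continuous_cosFactor : Continuous cosFactor := by
  unfold cosFactor
  fun_prop

@[fun_prop]
theorem continuous_sinFactor : Continuous sinFactor := by
  unfold sinFactor
  fun_prop

theorem cosFactor_eq (θ : ℝ) : cosFactor θ = (1 + exp (-(2 * I * θ))) / 2 := by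
  have h1 : exp (-(2 * I * θ)) = exp (-(I * θ)) * exp (-(I * θ)) := by
    rw [← exp_add]
    ring_nf
  have h2 : exp (θ * I) * exp (-(I * θ)) = 1 := by
    rw [← exp_add, mul_comm, add_neg_cancel, exp_zero]
  rw [cosFactor, ofReal_cos, Complex.cos, h1, show -(θ : ℂ) * I = -(I * θ) by ring]
  linear_combination h2 / 2

theorem sinFactor_eq (θ : ℝ) : sinFactor θ = 1 - cosFactor θ := by
  have h1 : exp (-(2 * I * θ)) = exp (-(I * θ)) * exp (-(I * θ)) := by
    rw [← exp_add]
    ring_nf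
  have h2 : exp (θ * I) * exp (-(I * θ)) = 1 := by
    rw [← exp_add, mul_comm, add_neg_cancel, exp_zero]
  rw [cosFactor_eq, sinFactor, ofReal_sin, Complex.sin, h1, show -(θ : ℂ) * I = -(I * θ) by ring]
  linear_combination h2 / 2 + (exp (-(I * θ)) * exp (-(I * θ)) - exp (θ * I) * exp (-(I * θ))) / 2 *
    I_sq

theorem exp_mul_exp_neg_rotation (θ : ℝ) : exp (2 * I * θ) * exp (-(2 * I * θ)) = 1 := by
  rw [← exp_add, add_neg_cancel, exp_zero]

/-- Scaling by t = r + s, the semicircle deformation in u for each fixed t, and an interchange of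
the t and θ integrals. The interchange is safe since the new denominator has no zero on the compact
parameter set. -/
theorem integral_rotated_eq {γ : ℝ} (hγ : 0 < γ) {z : ℂ} (hz : 0 < z.im) {a b : ℂ → ℂ}
    (ha : Differentiable ℂ a) (hb : Differentiable ℂ b) :
    ∫ r in Ioi (0 : ℝ), ∫ s in Ioi (0 : ℝ), a r * b s * truncatedResolvent γ z r s =
      I * ∫ θ, (∫ t in (0 : ℝ)..γ, (t : ℂ) * (a (t * cosFactor θ) * b (t * sinFactor θ)) /
        ((t : ℂ) ^ 2 - z * exp (2 * I * (θ.1 : ℂ)))) ∂(volumeIcc 0 (Real.pi / 2)) := by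
  have hac := ha.continuous
  have hbc := hb.continuous
  have hne : ∀ y : ℝ × ℝ, (y.1 : ℂ) ^ 2 - (y.2 : ℂ) ^ 2 - z ≠ 0 := fun y h => by
    have := congrArg im h
    simp [← ofReal_pow] at this
    exact hz.ne' this
  have hf : Continuous (Function.uncurry fun r s : ℝ =>
      a r * b s * (1 / ((r : ℂ) ^ 2 - (s : ℂ) ^ 2 - z))) := by
    refine Continuous.mul (by fun_prop) (Continuous.div (by fun_prop) (by fun_prop) hne)
  have hite : ∀ r s : ℝ, a r * b s * truncatedResolvent γ z r s =
      if r + s < γ then a r * b s * (1 / ((r : ℂ) ^ 2 - (s : ℂ) ^ 2 - z)) else 0 := fun r s => by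
    rw [truncatedResolvent, mul_ite, mul_zero]
  have hden : ∀ (t : ℝ) (θ : Angle), (t : ℂ) ^ 2 - z * exp (2 * I * (θ.1 : ℂ)) ≠ 0 := fun t θ =>
    sub_ne_zero.2 (sq_ne_rotation hz θ t)
  simp only [hite]
  rw [integral_triangle hf hγ]
  have hinner : ∀ t ∈ Ioc 0 γ, (t : ℂ) * ∫ u in (0 : ℝ)..1, a ((t * u : ℝ) : ℂ) *
      b ((t * (1 - u) : ℝ) : ℂ) *
        (1 / (((t * u : ℝ) : ℂ) ^ 2 - ((t * (1 - u) : ℝ) : ℂ) ^ 2 - z)) =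
      I * ∫ θ, (t : ℂ) * (a (t * cosFactor θ) * b (t * sinFactor θ)) /
        ((t : ℂ) ^ 2 - z * exp (2 * I * (θ.1 : ℂ))) ∂(volumeIcc 0 (Real.pi / 2)) := by
    intro t ht
    have ht0 : (t : ℂ) ≠ 0 := by exact_mod_cast ht.1.ne'
    have hw : 0 < ((1 + z / (t : ℂ) ^ 2) / 2).im := by
      have : ((1 + z / (t : ℂ) ^ 2) / 2).im = z.im / t ^ 2 / 2 := by
        rw [div_ofNat_im, add_im, one_im, zero_add, ← ofReal_pow, div_ofReal_im]
      rw [this]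
      have := ht.1
      positivity
    have hdiff : DifferentiableOn ℂ (fun u : ℂ => a (t * u) * b (t * (1 - u)) /
        ((t : ℂ) ^ 2 * (2 * u - 1) - z)) {(1 + z / (t : ℂ) ^ 2) / 2}ᶜ := by
      refine DifferentiableOn.div (by fun_prop) (by fun_prop) fun u hu h => hu ?_
      rw [mem_singleton_iff]
      field_simp
      linear_combination h
    have hseg := integral_segment_eq_integral_semicircle hw hdiff
    rw [integral_volumeIcc (by positivity) (fun θ : ℝ => (t : ℂ) *
      (a (t * cosFactor θ) * b (t * sinFactor θ)) / ((t : ℂ) ^ 2 - z * exp (2 * I * (θ : ℂ))))]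
    have e1 : ∫ u in (0 : ℝ)..1, a ((t * u : ℝ) : ℂ) * b ((t * (1 - u) : ℝ) : ℂ) *
        (1 / (((t * u : ℝ) : ℂ) ^ 2 - ((t * (1 - u) : ℝ) : ℂ) ^ 2 - z)) =
        ∫ u in (0 : ℝ)..1, a (t * u) * b (t * (1 - u)) / ((t : ℂ) ^ 2 * (2 * u - 1) - z) := by
      refine intervalIntegral.integral_congr fun u _ => ?_
      push_cast
      rw [mul_one_div]
      congr 1
      ring
    rw [e1, hseg, mul_left_comm, ← intervalIntegral.integral_const_mul]
    congr 1
    refine intervalIntegral.integral_congr fun θ _ => ?_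
    rw [← cosFactor_eq, ← sinFactor_eq]
    have h1 := exp_mul_exp_neg_rotation θ
    have h2 : exp (-(2 * I * θ)) ≠ 0 := exp_ne_zero _
    -- On the semicircle 2u - 1 = e^{-2iθ}; this factor cancels the one from du.
    have h3 : (t : ℂ) ^ 2 * (2 * cosFactor θ - 1) - z =
        ((t : ℂ) ^ 2 - z * exp (2 * I * (θ : ℂ))) * exp (-(2 * I * θ)) := by
      rw [cosFactor_eq]
      linear_combination z * h1
    rw [h3, div_mul_eq_mul_div, mul_div_mul_right _ _ h2, mul_div_assoc']
  rw [intervalIntegral.integral_congr_ae (.of_forall fun t ht => hinner t (by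
    rwa [uIoc_of_le hγ.le] at ht)), intervalIntegral.integral_const_mul]
  congr 1
  rw [← integral_volumeIcc hγ.le (fun t : ℝ => ∫ θ, (t : ℂ) *
    (a (t * cosFactor θ) * b (t * sinFactor θ)) /
      ((t : ℂ) ^ 2 - z * exp (2 * I * (θ.1 : ℂ))) ∂(volumeIcc 0 (Real.pi / 2)))]
  simp only [← integral_volumeIcc hγ.le]
  refine integral_integral_swap ?_
  have hcont : Continuous (Function.uncurry fun (t : Icc 0 γ) (θ : Angle) => (t.1 : ℂ) *
      (a (t.1 * cosFactor θ) * b (t.1 * sinFactor θ)) /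
        ((t.1 : ℂ) ^ 2 - z * exp (2 * I * (θ.1 : ℂ)))) := by
    refine Continuous.div ?_ (by fun_prop) fun y => hden y.1 y.2
    have := continuous_cosFactor
    have := continuous_sinFactor
    fun_prop
  exact hcont.integrable_of_hasCompactSupport (.of_compactSpace _)

theorem pow_mul_sq_pow {p ε l : ℕ} (h : p = 2 * l + 1 + ε) (t : ℂ) :
    t ^ (p - 1) = t ^ ε * (t ^ 2) ^ l := by
  rw [← pow_mul, ← pow_add]
  congr 1
  omega

/-- The angular representation for indefinite symbols. -/
def mixedRepresentation {p q ε l : ℕ} (hp : 1 ≤ p) (hq : 1 ≤ q) {γ : ℝ} (hγ : 0 < γ)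
    (hpq : p + q = 2 * l + 1 + ε) : AngularRepresentation p q ε l γ where
  μ := volumeIcc 0 (Real.pi / 2)
  finite := inferInstance
  C := 4 * (Real.pi : ℂ) ^ ((p : ℂ) / 2) * (Real.pi : ℂ) ^ ((q : ℂ) / 2) * I
  G x θ τ := cosFactor θ ^ (p - 1) * sinFactor θ ^ (q - 1) * τ ^ l *
    (besselSum p ((∑ j, x.1 j ^ 2) * (cosFactor θ ^ 2 * τ)) *
      besselSum q ((∑ j, x.2 j ^ 2) * (sinFactor θ ^ 2 * τ)))
  Gl x := ⟨fun k => cosFactor k.1 ^ (p - 1) * sinFactor k.1 ^ (q - 1) * Param.circlePoint γ k ^ l,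
      by fun_prop⟩ *
    (besselComp p ((∑ j, x.1 j ^ 2) •
        (⟨fun k => cosFactor k.1 ^ 2 * Param.circlePoint γ k, by fun_prop⟩ : C(Param γ, ℂ))) *
      besselComp q ((∑ j, x.2 j ^ 2) •
        (⟨fun k => sinFactor k.1 ^ 2 * Param.circlePoint γ k, by fun_prop⟩ : C(Param γ, ℂ))))
  differentiable x θ := by
    have h1 := differentiable_besselSum p
    have h2 := differentiable_besselSum q
    fun_prop
  continuous x := by
    have h : Continuous fun y : Angle × ℂ => cosFactor y.1 ^ (p - 1) * sinFactor y.1 ^ (q - 1) *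
      y.2 ^ l * (besselSum p ((∑ j, x.1 j ^ 2) * (cosFactor y.1 ^ 2 * y.2)) *
        besselSum q ((∑ j, x.2 j ^ 2) * (sinFactor y.1 ^ 2 * y.2))) := by fun_prop
    exact h
  analytic := analyticOnNhd_const.mul
    ((analyticOnNhd_besselComp_smul p (analyticOnNhd_sum_sq_fst p q) _).mul
      (analyticOnNhd_besselComp_smul q (analyticOnNhd_sum_sq_snd p q) _))
  lift_apply x k := rfl
  integral_eq z hz x := by
    have h1 := differentiable_besselSum p
    have h2 := differentiable_besselSum q
    rw [integral_integrand_eq hp hq γ hz, integral_rotated_eq hγ hz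
      (a := fun r => r ^ (p - 1) * besselSum p ((∑ j, x.1 j ^ 2) * r ^ 2))
      (b := fun s => s ^ (q - 1) * besselSum q ((∑ j, x.2 j ^ 2) * s ^ 2))
      (by fun_prop) (by fun_prop), ← mul_assoc]
    congr 1
    refine integral_congr_ae (.of_forall fun θ => intervalIntegral.integral_congr fun t _ => ?_)
    have ht : (t : ℂ) * (t : ℂ) ^ (p - 1) * (t : ℂ) ^ (q - 1) =
        (t : ℂ) ^ ε * ((t : ℂ) ^ 2) ^ l := by
      rw [← pow_mul_sq_pow hpq, ← pow_succ', ← pow_add]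
      congr 1
      omega
    congr 1
    simp only [mul_pow]
    rw [mul_comm ((t : ℂ) ^ 2) (cosFactor θ ^ 2), mul_comm ((t : ℂ) ^ 2) (sinFactor θ ^ 2)]
    linear_combination (cosFactor θ ^ (p - 1) * sinFactor θ ^ (q - 1) *
      (besselSum p ((∑ j, x.1 j ^ 2) * (cosFactor θ ^ 2 * (t : ℂ) ^ 2)) *
        besselSum q ((∑ j, x.2 j ^ 2) * (sinFactor θ ^ 2 * (t : ℂ) ^ 2)))) * ht
  singular_eq z x := by
    set A := ∑ j, x.1 j ^ 2
    set B := ∑ j, x.2 j ^ 2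
    have hint : ∀ θ : Angle, exp (-((1 - (ε : ℂ)) * (I * (θ.1 : ℂ)))) *
        (cosFactor θ ^ (p - 1) * sinFactor θ ^ (q - 1) * (z * exp (2 * I * (θ.1 : ℂ))) ^ l *
          (besselSum p (A * (cosFactor θ ^ 2 * (z * exp (2 * I * (θ.1 : ℂ))))) *
            besselSum q (B * (sinFactor θ ^ 2 * (z * exp (2 * I * (θ.1 : ℂ))))))) =
        I ^ (q - 1) * z ^ l * ((Real.cos θ : ℂ) ^ (p - 1) * (Real.sin θ : ℂ) ^ (q - 1) *
          (besselSum p (z * A * (Real.cos θ : ℂ) ^ 2) *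
            besselSum q (-(z * B) * (Real.sin θ : ℂ) ^ 2))) := fun θ => by
      have e : exp (-(I * θ.1)) ^ 2 * exp (2 * I * θ.1) = 1 := by
        rw [← exp_nat_mul, ← exp_add]
        push_cast
        ring_nf
        exact exp_zero
      -- The total exponent is -iθ((1 - ε) + (p - 1) + (q - 1) - 2l), which vanishes because p + q =
      -- 2l + 1 + ε.
      have hphase : exp (-((1 - (ε : ℂ)) * (I * (θ.1 : ℂ)))) * (exp (-(I * θ.1)) ^ (p - 1) *
          exp (-(I * θ.1)) ^ (q - 1) * exp (2 * I * θ.1) ^ l) = 1 := by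
        rw [← exp_nat_mul, ← exp_nat_mul, ← exp_nat_mul, ← exp_add, ← exp_add, ← exp_add]
        convert exp_zero using 2
        have hpq' : (p : ℂ) + q = 2 * l + 1 + ε := by exact_mod_cast hpq
        push_cast [hp, hq]
        linear_combination -(I * (θ.1 : ℂ)) * hpq'
      have hA : A * (cosFactor θ ^ 2 * (z * exp (2 * I * (θ.1 : ℂ)))) =
          z * A * (Real.cos θ : ℂ) ^ 2 := by
        rw [cosFactor]
        linear_combination (z * A * (Real.cos θ : ℂ) ^ 2) * e
      -- The square of i in `sinFactor` gives the minus sign before x''².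
      have hB : B * (sinFactor θ ^ 2 * (z * exp (2 * I * (θ.1 : ℂ)))) =
          -(z * B) * (Real.sin θ : ℂ) ^ 2 := by
        rw [sinFactor, mul_pow, mul_pow, I_sq]
        linear_combination (-(z * B) * (Real.sin θ : ℂ) ^ 2) * e
      rw [hA, hB, cosFactor, sinFactor, mul_pow, mul_pow, mul_pow, mul_pow]
      linear_combination (I ^ (q - 1) * z ^ l * ((Real.cos θ : ℂ) ^ (p - 1) *
        (Real.sin θ : ℂ) ^ (q - 1) * (besselSum p (z * A * (Real.cos θ : ℂ) ^ 2) *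
            besselSum q (-(z * B) * (Real.sin θ : ℂ) ^ 2)))) * hphase
    simp only [hint]
    rw [integral_const_mul, integral_volumeIcc (by positivity) (fun θ : ℝ =>
      (Real.cos θ : ℂ) ^ (p - 1) * (Real.sin θ : ℂ) ^ (q - 1) *
          (besselSum p (z * A * (Real.cos θ : ℂ) ^ 2) *
            besselSum q (-(z * B) * (Real.sin θ : ℂ) ^ 2))),
      integral_besselSum_mul_besselSum hp hq, form, mul_sub, ← sub_eq_add_neg]
    have hI : I ^ q = I * I ^ (q - 1) := by
      rw [← pow_succ']
      congr 1
      omega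
    have hpi : (Real.pi : ℂ) ^ (((p + q : ℕ) : ℂ) / 2) =
        (Real.pi : ℂ) ^ ((p : ℂ) / 2) * (Real.pi : ℂ) ^ ((q : ℂ) / 2) := by
      rw [← cpow_add _ _ (by exact_mod_cast Real.pi_ne_zero)]
      push_cast
      ring_nf
    rw [hI, hpi]
    ring

/-! ### The definite signatures. -/

theorem integral_euclideanSpace_fin_zero (f : EuclideanSpace ℝ (Fin 0) → ℂ) :
    ∫ η, f η = f 0 := by
  rw [← (PiLp.volume_preserving_toLp (Fin 0)).integral_comp
    (MeasurableEquiv.toLp 2 _).measurableEmbedding, Measure.volume_pi_eq_dirac, integral_dirac]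
  congr 1
  exact Subsingleton.elim _ _

theorem integral_Ioi_ite (f : ℝ → ℂ) {γ : ℝ} (hγ : 0 < γ) :
    ∫ r in Ioi (0 : ℝ), (if r < γ then f r else 0) = ∫ r in (0 : ℝ)..γ, f r := by
  have h : (fun r => if r < γ then f r else 0) = (Iio γ).indicator f := by
    ext r
    simp [indicator_apply]
  rw [h, setIntegral_indicator measurableSet_Iio, Ioi_inter_Iio,
    intervalIntegral.integral_of_le hγ.le, integral_Ioc_eq_integral_Ioo]

theorem integral_integrand_fst {p : ℕ} (hp : 1 ≤ p) {γ : ℝ} (hγ : 0 < γ) {z : ℂ} (hz : 0 < z.im)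
    (x : Pos p 0) :
    ∫ ξ in region p 0 γ, integrand z x ξ = 2 * (Real.pi : ℂ) ^ ((p : ℂ) / 2) *
      ∫ r in (0 : ℝ)..γ, (r : ℂ) ^ (p - 1) * besselSum p ((∑ j, x.1 j ^ 2) * (r : ℂ) ^ 2) /
        ((r : ℂ) ^ 2 - z) := by
  have hint := (integrableOn_integrand γ hz x).integrable_indicator (measurableSet_region p 0 γ)
  rw [funext (indicator_integrand γ z x), Measure.volume_eq_prod] at hint
  have hinner : ∀ ξ : EuclideanSpace ℝ (Fin p), ∫ η : EuclideanSpace ℝ (Fin 0),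
      exp (I * linearForm x.1 ξ) * (exp (I * linearForm x.2 η) *
        truncatedResolvent γ z ‖ξ‖ ‖η‖) = exp (I * linearForm x.1 ξ) *
          (fun r => truncatedResolvent γ z r 0) ‖ξ‖ := fun ξ => by
    rw [integral_euclideanSpace_fin_zero]
    simp [linearForm]
  rw [← integral_indicator (measurableSet_region p 0 γ), funext (indicator_integrand γ z x),
    Measure.volume_eq_prod, integral_prod _ hint, integral_congr_ae (.of_forall hinner),
    integral_exp_mul_radial hp x.1 (fun r => truncatedResolvent γ z r 0)
      (hint.integral_prod_left.congr (.of_forall hinner)), ← integral_Ioi_ite _ hγ]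
  congr 1
  refine integral_congr_ae (.of_forall fun r => ?_)
  simp only [truncatedResolvent, add_zero, besselSum]
  split_ifs
  · simp only [ofReal_zero]
    ring
  · ring

theorem integral_integrand_snd {q : ℕ} (hq : 1 ≤ q) {γ : ℝ} (hγ : 0 < γ) {z : ℂ} (hz : 0 < z.im)
    (x : Pos 0 q) :
    ∫ ξ in region 0 q γ, integrand z x ξ = -(2 * (Real.pi : ℂ) ^ ((q : ℂ) / 2)) *
      ∫ r in (0 : ℝ)..γ, (r : ℂ) ^ (q - 1) * besselSum q ((∑ j, x.2 j ^ 2) * (r : ℂ) ^ 2) /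
        ((r : ℂ) ^ 2 + z) := by
  have hint := (integrableOn_integrand γ hz x).integrable_indicator (measurableSet_region 0 q γ)
  rw [funext (indicator_integrand γ z x), Measure.volume_eq_prod] at hint
  have hinner : ∀ η : EuclideanSpace ℝ (Fin q), ∫ ξ : EuclideanSpace ℝ (Fin 0),
      exp (I * linearForm x.1 ξ) * (exp (I * linearForm x.2 η) *
        truncatedResolvent γ z ‖ξ‖ ‖η‖) = exp (I * linearForm x.2 η) *
          (fun r => truncatedResolvent γ z 0 r) ‖η‖ := fun η => by
    rw [integral_euclideanSpace_fin_zero]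
    simp [linearForm]
  rw [← integral_indicator (measurableSet_region 0 q γ), funext (indicator_integrand γ z x),
    Measure.volume_eq_prod, integral_prod_symm _ hint, integral_congr_ae (.of_forall hinner),
    integral_exp_mul_radial hq x.2 (fun r => truncatedResolvent γ z 0 r)
      (hint.integral_prod_right.congr (.of_forall hinner)), neg_mul, ← mul_neg,
    ← intervalIntegral.integral_neg, ← integral_Ioi_ite _ hγ]
  congr 1
  refine integral_congr_ae (.of_forall fun r => ?_)
  simp only [truncatedResolvent, zero_add, besselSum]
  split_ifs
  · rw [ofReal_zero, show (0 : ℂ) ^ 2 - (r : ℂ) ^ 2 - z = -((r : ℂ) ^ 2 + z) by ring, one_div,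
      inv_neg]
    ring
  · ring

/-- The angular representation for positive definite symbols. -/
def positiveRepresentation {p ε l : ℕ} {γ : ℝ} (hγ : 0 < γ) (hp : p = 2 * l + 1 + ε) :
    AngularRepresentation p 0 ε l γ where
  -- No rotation is needed: θ = 0 gives ζ = z.
  μ := Measure.dirac ⟨0, le_rfl, by positivity⟩
  finite := inferInstance
  C := 2 * (Real.pi : ℂ) ^ ((p : ℂ) / 2)
  G x _ τ := τ ^ l * besselSum p ((∑ j, x.1 j ^ 2) * τ)
  Gl x := Param.circlePoint γ ^ l * besselComp p ((∑ j, x.1 j ^ 2) • Param.circlePoint γ)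
  differentiable x θ := by
    have := differentiable_besselSum p
    fun_prop
  continuous x := by
    have h : Continuous fun y : Angle × ℂ => y.2 ^ l * besselSum p ((∑ j, x.1 j ^ 2) * y.2) := by
      fun_prop
    exact h
  analytic := analyticOnNhd_const.mul
    (analyticOnNhd_besselComp_smul p (analyticOnNhd_sum_sq_fst p 0) _)
  lift_apply x k := rfl
  integral_eq z hz x := by
    rw [integral_integrand_fst (by omega) hγ hz, integral_dirac]
    congr 1
    refine intervalIntegral.integral_congr fun t _ => ?_
    simp only [ofReal_zero, mul_zero, exp_zero, mul_one]
    rw [pow_mul_sq_pow hp, mul_assoc]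
  singular_eq z x := by
    rw [integral_dirac]
    simp [form]
    ring_nf

/-- The angular representation for negative definite symbols. -/
def negativeRepresentation {q ε l : ℕ} {γ : ℝ} (hγ : 0 < γ) (hq : q = 2 * l + 1 + ε)
    (hε : ε = 0 ∨ ε = 1) : AngularRepresentation 0 q ε l γ where
  -- At θ = π/2 one has ζ = -z, and t² + z is the denominator up to the sign carried by `C`.
  μ := Measure.dirac ⟨Real.pi / 2, by positivity, le_rfl⟩
  finite := inferInstance
  C := -(2 * (Real.pi : ℂ) ^ ((q : ℂ) / 2))
  G x _ τ := τ ^ l * besselSum q ((∑ j, x.2 j ^ 2) * τ)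
  Gl x := Param.circlePoint γ ^ l * besselComp q ((∑ j, x.2 j ^ 2) • Param.circlePoint γ)
  differentiable x θ := by
    have := differentiable_besselSum q
    fun_prop
  continuous x := by
    have h : Continuous fun y : Angle × ℂ => y.2 ^ l * besselSum q ((∑ j, x.2 j ^ 2) * y.2) := by
      fun_prop
    exact h
  analytic := analyticOnNhd_const.mul
    (analyticOnNhd_besselComp_smul q (analyticOnNhd_sum_sq_snd 0 q) _)
  lift_apply x k := rfl
  integral_eq z hz x := by
    rw [integral_integrand_snd (by omega) hγ hz, integral_dirac]
    congr 1
    refine intervalIntegral.integral_congr fun t _ => ?_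
    have h : exp (2 * I * ((Real.pi / 2 : ℝ) : ℂ)) = -1 := by
      rw [← exp_pi_mul_I]
      push_cast
      ring_nf
    simp only [h]
    rw [pow_mul_sq_pow hq, mul_assoc, mul_neg_one, sub_neg_eq_add]
  singular_eq z x := by
    have h : exp (2 * I * ((Real.pi / 2 : ℝ) : ℂ)) = -1 := by
      rw [← exp_pi_mul_I]
      push_cast
      ring_nf
    -- Since q = 2l + 1 + ε, the power splits into i^{1+ε}, from `C` and the singular coefficient at
    -- θ = π/2, and (-1)^l from ζ^l.
    have hI : I ^ q = -exp (-((1 - (ε : ℂ)) * (I * ((Real.pi / 2 : ℝ) : ℂ)))) * (-1) ^ l := by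
      have h1 : -exp (-((1 - (ε : ℂ)) * (I * ((Real.pi / 2 : ℝ) : ℂ)))) = I ^ (1 + ε) := by
        rcases hε with rfl | rfl
        · rw [Nat.cast_zero, sub_zero, one_mul, exp_neg, mul_comm I]
          push_cast
          rw [exp_pi_div_two_mul_I]
          simp
        · simp
      rw [h1, hq, ← I_sq, ← pow_mul, ← pow_add]
      congr 1
      omega
    rw [integral_dirac]
    simp only [h]
    have hf : form x = -∑ j, x.2 j ^ 2 := by simp [form]
    rw [zero_add, hI, hf, mul_neg_one, neg_pow z, mul_neg, mul_neg, mul_comm z (∑ j, x.2 j ^ 2)]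
    ring

end UltraHyperbolic

end

theorem theorem150803236 (p q : ℕ) (hd : 1 ≤ p + q) (γ : ℝ) (hγ : 0 < γ) :
    (Odd (p + q) →
      ∃ χ : ℂ × UltraHyperbolic.Pos p q → ℂ,
        AnalyticOnNhd ℂ χ (Metric.ball (0 : ℂ) (γ ^ 2) ×ˢ Set.univ) ∧
        ∀ z : ℂ, 0 < z.im → ‖z‖ < γ ^ 2 → ∀ x : UltraHyperbolic.Pos p q,
          UltraHyperbolic.kernel γ z x =
            Complex.I * (Real.pi : ℂ) * Complex.sqrt z ^ (((p + q : ℕ) : ℤ) - 2) *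
              UltraHyperbolic.E p q (z * UltraHyperbolic.form x) + χ (z, x)) ∧
    (Even (p + q) →
      ∃ χ : ℂ × UltraHyperbolic.Pos p q → ℂ,
        AnalyticOnNhd ℂ χ (Metric.ball (0 : ℂ) (γ ^ 2) ×ˢ Set.univ) ∧
        ∀ z : ℂ, 0 < z.im → ‖z‖ < γ ^ 2 → ∀ x : UltraHyperbolic.Pos p q,
          UltraHyperbolic.kernel γ z x =
            -(Complex.sqrt z ^ (((p + q : ℕ) : ℤ) - 2) * Complex.log z *
              UltraHyperbolic.E p q (z * UltraHyperbolic.form x)) + χ (z, x)) := by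
  have key : ∀ ε l : ℕ, ε = 0 ∨ ε = 1 → p + q = 2 * l + 1 + ε →
      Nonempty (UltraHyperbolic.AngularRepresentation p q ε l γ) := by
    intro ε l hε h
    rcases Nat.eq_zero_or_pos q with rfl | hq
    · exact ⟨UltraHyperbolic.positiveRepresentation hγ (by omega)⟩
    · rcases Nat.eq_zero_or_pos p with rfl | hp
      · exact ⟨UltraHyperbolic.negativeRepresentation hγ (by omega) hε⟩
      · exact ⟨UltraHyperbolic.mixedRepresentation hp hq hγ h⟩
  constructor
  · rintro ⟨l, hl⟩
    obtain ⟨A⟩ := key 0 l (.inl rfl) hl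
    exact A.odd hγ hl
  · rintro ⟨m, hm⟩
    -- An even d ≥ 1 is at least 2, so d = 2l + 2 with a natural number l.
    obtain ⟨l, rfl⟩ : ∃ l, m = l + 1 := ⟨m - 1, by omega⟩
    obtain ⟨A⟩ := key 1 l (.inr rfl) (by omega)
    exact A.even hγ (by omega)
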